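/- **Lemma 3.1.** Let $L=2\ell$ with $\ell\ge 1$ an integer, let $\beta\ge 0$ and $t>0$, and let $\Gamma_L=\mathbb{Z}^2/L\mathbb{Z}^2$ be the two-dimensional discrete torus with unit vectors $e_1,e_2$. Let $\mathcal{F}_L$ be the fermionic Fock space over $\ell^2(\Gamma_L)$, with creation and annihilation operators $a^\pm_x$, $x\in\Gamma_L$, and number operator $N=\sum_x a^+_xa^-_x$. Cut the torus into two halves orthogonally to a lattice direction $e_\mu$, $\mu\in\{1,2\}$: for some $c\in\mathbb{Z}/L\mathbb{Z}$, the left half $\Gamma^{\mathrm l}_L$ consists of the sites with $x_\mu\in\{c,c+1,\dots,c+\ell-1\}$ and the right half is $\Gamma_L^{\mathrm r}=\Gamma_L\setminus\Gamma_L^{\mathrm l}$. Let $r$ be the geometric reflection across the cut, i.e. the map $x_\mu\mapsto 2c-1-x_\mu$ that leaves the other coordinate fixed, and let $$V_{\rm int}=-t\sum_{x}\big(a^+_xa^-_{x+e_\mu}+a^+_{x+e_\mu}a^-_x\big),$$ where the sum is over all $x\in\Gamma_L$ such that $x$ and $x+e_\mu$ lie in different halves (so both lines of bonds at which the torus is cut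 are included). Let $\mathcal{R}$, $\tau$ be the unitary operators on $\mathcal{F}_L$ (unique up to a phase) with $\mathcal{R}^*a^\pm_x\mathcal{R}=a^\pm_{r(x)}$ and $\tau^*a^\pm_x\tau=a^\mp_x$ for all $x$, and let $\Theta(\mathcal{O})=\overline{\tau^*\mathcal{R}^*\mathcal{O}\mathcal{R}\tau}$, where the bar denotes the complex conjugation of the coefficients of the monomials in the $a^\pm_x$. Thus $\Theta$ is the antilinear automorphism with $\Theta(a^\pm_x)=a^\mp_{r(x)}$. For operators $H_1,H_2$ on $\mathcal{F}_L$ put $$Z^+(H_1,H_2)=\operatorname{Tr}\,e^{-\beta(H_1+H_2+V_{\rm int})},\qquad Z^-(H_1,H_2)=\operatorname{Tr}\,(-1)^N e^{-\beta(H_1+H_2+V_{\rm int})}.$$ Let $H^{\mathrm l}$ (resp. $H^{\mathrm r}$) be a self-adjoint polynomial in the operators $a^\pm_x$ with $x\in\Gamma^{\mathrm l}_L$ (resp. $x\in\Gamma^{\mathrm r}_L$) which conserves the particle number, i.e. commutes with $N$. Then, for both choices of the sign $\pm$, the numbers $Z^\pm(H^{\mathrm l},H^{\mathrm r})$, $Z^\pm(H^{\mathrm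 l},\Theta(H^{\mathrm l}))$, $Z^\pm(H^{\mathrm r},\Theta(H^{\mathrm r}))$ are real and $$Z^{\pm}(H^{\mathrm l},H^{\mathrm r})^2\;\le\; Z^{\pm}(H^{\mathrm l},\Theta(H^{\mathrm l}))\;Z^{\pm}(H^{\mathrm r},\Theta(H^{\mathrm r})).$$ -/

import Mathlib

open scoped Matrix

namespace LatticeFermion

/-! ### Fermionic Fock space over a finite set of sites

The occupation number basis of the Fock space over a finite set `V` of sites is indexed by the
sets `S : Finset V` of occupied sites; operators are matrices in this orthonormal basis. -/

/-- Operators on the fermionic Fock space over `V` (of dimension `2 ^ |V|`). -/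
abbrev FockOp (V : Type) : Type := Matrix (Finset V) (Finset V) ℂ

/-- The sign `(-1)^{#{y ∈ S : y before x}}`, for a fixed enumeration of the sites. -/
noncomputable def orderSign {V : Type} [Fintype V] (x : V) (S : Finset V) : ℂ :=
  (-1) ^ (S.filter (fun y => Fintype.equivFin V y < Fintype.equivFin V x)).card

/-- The annihilation operator `a⁻_x`: `|S⟩ ↦ ± |S \ {x}⟩` if `x ∈ S`, and `|S⟩ ↦ 0` otherwise. -/
noncomputable def ann {V : Type} [Fintype V] [DecidableEq V] (x : V) : FockOp V :=
  Matrix.of fun T S => if x ∈ S ∧ T = S.erase x then orderSign x S else 0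

/-- The creation operator `a⁺_x = (a⁻_x)*`. -/
noncomputable def cre {V : Type} [Fintype V] [DecidableEq V] (x : V) : FockOp V :=
  (ann x)ᴴ

/-- The number operator `N = ∑ₓ a⁺_x a⁻_x`. -/
noncomputable def number (V : Type) [Fintype V] [DecidableEq V] : FockOp V :=
  ∑ x : V, cre x * ann x

/-- The parity operator `(-1)^N`, diagonal in the occupation number basis. -/
noncomputable def parity (V : Type) [DecidableEq V] : FockOp V :=
  Matrix.diagonal fun S => (-1) ^ S.card

/-- The algebra of polynomials in the operators `a⁺_x`, `a⁻_x` with `x ∈ s`. -/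
noncomputable def localAlgebra {V : Type} [Fintype V] [DecidableEq V] (s : Finset V) :
    Subalgebra ℂ (FockOp V) :=
  Algebra.adjoin ℂ ({A | ∃ x ∈ s, A = ann x} ∪ {A | ∃ x ∈ s, A = cre x})

/-! Canonical anticommutation relations. -/

theorem ann_apply {V : Type} [Fintype V] [DecidableEq V] (x : V) (T S : Finset V) :
    ann x T S = if x ∈ S ∧ T = S.erase x then orderSign x S else 0 := rfl

theorem mul_ann_apply {V : Type} [Fintype V] [DecidableEq V] (A : FockOp V) (y : V)
    (T S : Finset V) :
    (A * ann y) T S = if y ∈ S then A T (S.erase y) * orderSign y S else 0 := by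
  rw [Matrix.mul_apply]
  by_cases h : y ∈ S
  · simp [ann, h]
  · simp [ann, h]

theorem orderSign_erase_self {V : Type} [Fintype V] [DecidableEq V] (x : V) (S : Finset V) :
    orderSign x (S.erase x) = orderSign x S := by
  unfold orderSign
  congr 2
  ext y
  simp only [Finset.mem_filter, Finset.mem_erase]
  constructor
  · rintro ⟨⟨_, h⟩, h'⟩
    exact ⟨h, h'⟩
  · rintro ⟨h, h'⟩
    refine ⟨⟨?_, h⟩, h'⟩
    rintro rfl
    exact lt_irrefl _ h'

theorem cre_apply {V : Type} [Fintype V] [DecidableEq V] (x : V) (T S : Finset V) :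
    cre x T S = if x ∉ S ∧ T = insert x S then orderSign x S else 0 := by
  have hst : ∀ U : Finset V, star (orderSign x U) = orderSign x U := by
    intro U
    simp [orderSign]
  simp only [cre, ann, Matrix.conjTranspose_apply, Matrix.of_apply]
  by_cases h : x ∈ T ∧ S = T.erase x
  · obtain ⟨h1, rfl⟩ := h
    simp [h1, hst, orderSign_erase_self]
  · rw [if_neg h, if_neg]
    · simp
    · rintro ⟨h1, rfl⟩
      exact h ⟨Finset.mem_insert_self _ _, (Finset.erase_insert h1).symm⟩

theorem mul_cre_apply {V : Type} [Fintype V] [DecidableEq V] (A : FockOp V) (y : V)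
    (T S : Finset V) :
    (A * cre y) T S = if y ∉ S then A T (insert y S) * orderSign y S else 0 := by
  rw [Matrix.mul_apply]
  by_cases h : y ∈ S
  · simp [cre_apply, h]
  · simp [cre_apply, h]

/-- `-1` if `y` comes before `x`, and `1` otherwise. -/
noncomputable def before {V : Type} [Fintype V] (x y : V) : ℂ :=
  if Fintype.equivFin V y < Fintype.equivFin V x then -1 else 1

theorem orderSign_insert {V : Type} [Fintype V] [DecidableEq V] (x y : V) (S : Finset V)
    (h : y ∉ S) : orderSign x (insert y S) = before x y * orderSign x S := by
  unfold orderSign before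
  rw [Finset.filter_insert]
  split_ifs with h1
  · rw [Finset.card_insert_of_notMem (by simp [h])]
    ring
  · ring

theorem orderSign_erase {V : Type} [Fintype V] [DecidableEq V] (x y : V) (S : Finset V)
    (h : y ∈ S) : orderSign x (S.erase y) = before x y * orderSign x S := by
  have h1 := orderSign_insert x y (S.erase y) (Finset.notMem_erase y S)
  rw [Finset.insert_erase h] at h1
  rw [h1, ← mul_assoc]
  have : before x y * before x y = 1 := by
    unfold before
    split_ifs <;> norm_num
  rw [this, one_mul]

theorem before_swap {V : Type} [Fintype V] (x y : V) (h : x ≠ y) :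
    before x y = - before y x := by
  have h' : Fintype.equivFin V x ≠ Fintype.equivFin V y := fun e =>
    h ((Fintype.equivFin V).injective e)
  unfold before
  rcases lt_or_gt_of_ne h' with h1 | h1
  · simp [h1, not_lt.mpr h1.le]
  · simp [h1, not_lt.mpr h1.le]

theorem orderSign_mul_self {V : Type} [Fintype V] (x : V) (S : Finset V) :
    orderSign x S * orderSign x S = 1 := by
  unfold orderSign
  rw [← mul_pow]
  norm_num

theorem ann_mul_ann {V : Type} [Fintype V] [DecidableEq V] (x y : V) :
    ann x * ann y = - (ann y * ann x : FockOp V) := by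
  by_cases hxy : x = y
  · subst hxy
    ext T S
    simp [mul_ann_apply, ann_apply]
  ext T S
  have hyx : y ≠ x := fun h => hxy h.symm
  simp only [mul_ann_apply, ann_apply, Matrix.neg_apply, Finset.mem_erase]
  by_cases hx : x ∈ S <;> by_cases hy : y ∈ S <;> simp [hx, hy, hxy, hyx]
  rw [orderSign_erase x y S hy, orderSign_erase y x S hx, Finset.erase_right_comm,
    before_swap x y hxy]
  split_ifs <;> ring

theorem cre_mul_cre {V : Type} [Fintype V] [DecidableEq V] (x y : V) :
    cre x * cre y = - (cre y * cre x : FockOp V) := by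
  have h := congrArg Matrix.conjTranspose (ann_mul_ann y x)
  simpa [cre, Matrix.conjTranspose_mul] using h

theorem ann_mul_cre_self {V : Type} [Fintype V] [DecidableEq V] (x : V) :
    ann x * cre x = (1 - cre x * ann x : FockOp V) := by
  ext T S
  rw [mul_cre_apply, Matrix.sub_apply, mul_ann_apply, ann_apply, cre_apply, Matrix.one_apply]
  have h1 := orderSign_mul_self x S
  by_cases hx : x ∈ S
  · simp [hx, orderSign_erase_self]
    split_ifs <;> simp [h1]
  · have h2 := orderSign_erase_self x (insert x S)
    rw [Finset.erase_insert hx] at h2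
    simp [hx, ← h2]
    split_ifs <;> simp [h1]

theorem ann_mul_cre {V : Type} [Fintype V] [DecidableEq V] (x y : V) (hxy : x ≠ y) :
    ann x * cre y = - (cre y * ann x : FockOp V) := by
  ext T S
  have hyx : y ≠ x := fun h => hxy h.symm
  rw [mul_cre_apply, Matrix.neg_apply, mul_ann_apply, ann_apply, cre_apply]
  simp only [Finset.mem_erase, Finset.mem_insert]
  by_cases hx : x ∈ S <;> by_cases hy : y ∈ S <;> simp [hx, hy, hxy, hyx]
  rw [orderSign_insert x y S hy, orderSign_erase y x S hx, Finset.erase_insert_of_ne hyx,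
    before_swap x y hxy]
  split_ifs <;> ring

theorem cre_mul_ann {V : Type} [Fintype V] [DecidableEq V] (x y : V) (hxy : x ≠ y) :
    cre x * ann y = - (ann y * cre x : FockOp V) := by
  rw [ann_mul_cre y x hxy.symm, neg_neg]

theorem ann_sq {V : Type} [Fintype V] [DecidableEq V] (x : V) :
    ann x * ann x = (0 : FockOp V) := by
  ext T S
  simp [mul_ann_apply, ann_apply]

theorem cre_sq {V : Type} [Fintype V] [DecidableEq V] (x : V) :
    cre x * cre x = (0 : FockOp V) := by
  ext T S
  simp [mul_cre_apply, cre_apply]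

theorem cre_conjTranspose {V : Type} [Fintype V] [DecidableEq V] (x : V) :
    (cre x : FockOp V)ᴴ = ann x := by
  simp [cre]

theorem ann_map_conj {V : Type} [Fintype V] [DecidableEq V] (x : V) :
    (ann x : FockOp V).map (starRingEnd ℂ) = ann x := by
  ext T S
  rw [Matrix.map_apply, ann_apply]
  split_ifs <;> simp [orderSign]

theorem cre_map_conj {V : Type} [Fintype V] [DecidableEq V] (x : V) :
    (cre x : FockOp V).map (starRingEnd ℂ) = cre x := by
  ext T S
  rw [Matrix.map_apply, cre_apply]
  split_ifs <;> simp [orderSign]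

theorem number_eq_diagonal (V : Type) [Fintype V] [DecidableEq V] :
    number V = Matrix.diagonal fun S => (S.card : ℂ) := by
  ext T S
  have key : ∀ x : V, (cre x * ann x : FockOp V) T S = if x ∈ S then (if T = S then 1 else 0)
      else 0 := by
    intro x
    rw [mul_ann_apply, cre_apply]
    by_cases hx : x ∈ S
    · simp [hx, orderSign_erase_self]
      split_ifs <;> simp [orderSign_mul_self]
    · simp [hx]
  rw [number, Matrix.sum_apply, Finset.sum_congr rfl (fun x _ => key x), Matrix.diagonal_apply]
  by_cases h : T = S
  · subst h
    simp
  · simp [h]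

theorem parity_mul_ann {V : Type} [Fintype V] [DecidableEq V] (x : V) :
    parity V * ann x = - (ann x * parity V) := by
  ext T S
  rw [parity, Matrix.neg_apply, Matrix.diagonal_mul, Matrix.mul_diagonal, ann_apply]
  split_ifs with h
  · obtain ⟨h1, rfl⟩ := h
    have h2 := Finset.card_erase_add_one h1
    rw [← h2, pow_succ]
    ring
  · simp

theorem parity_mul_parity (V : Type) [Fintype V] [DecidableEq V] :
    parity V * parity V = 1 := by
  rw [parity, Matrix.diagonal_mul_diagonal, ← Matrix.diagonal_one]
  congr 1
  funext S
  rw [← mul_pow]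
  norm_num

theorem parity_conjTranspose (V : Type) [DecidableEq V] : (parity V)ᴴ = parity V := by
  rw [parity, Matrix.diagonal_conjTranspose]
  congr 1
  funext S
  simp

/-! ### The unitary implementing a reflection of the sites -/

/-- The operator exchanging the sites `x` and `y` (the identity if `x = y`). -/
noncomputable def swapOp {V : Type} [Fintype V] [DecidableEq V] (x y : V) : FockOp V :=
  1 - (cre x - cre y) * (ann x - ann y)

/-- The unitary `R` with `R* a^±_x R = a^±_{r(x)}` for an involution `r` of the sites which
exchanges `s` with its complement (see `reflectionUnitary_ann`): the product of the operators
exchanging `x` and `r(x)`, `x ∈ s`. -/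
noncomputable def reflectionUnitary {V : Type} [Fintype V] [DecidableEq V] (r : V → V)
    (s : Finset V) : FockOp V :=
  (s.toList.map fun x => swapOp x (r x)).prod

theorem swapOp_conjTranspose {V : Type} [Fintype V] [DecidableEq V] (x y : V) :
    (swapOp x y : FockOp V)ᴴ = swapOp x y := by
  simp [swapOp, cre, Matrix.conjTranspose_sub, Matrix.conjTranspose_mul]

theorem swapOp_mul_ann {V : Type} [Fintype V] [DecidableEq V] (x y : V) (hxy : x ≠ y) :
    swapOp x y * ann x = (ann y * swapOp x y : FockOp V) := by
  have h1 : ann y * (cre x - cre y) = (-1 - (cre x - cre y) * ann y : FockOp V) := by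
    rw [mul_sub, ann_mul_cre y x hxy.symm, ann_mul_cre_self]
    noncomm_ring
  have h2 : (ann x - ann y) * ann x = (- (ann y * ann x) : FockOp V) := by
    rw [sub_mul, ann_sq]
    noncomm_ring
  have h3 : ann y * (ann x - ann y) = (ann y * ann x : FockOp V) := by
    rw [mul_sub, ann_sq]
    noncomm_ring
  have h4 : ann y * ((cre x - cre y) * (ann x - ann y)) =
      (-(ann x - ann y) - (cre x - cre y) * (ann y * ann x) : FockOp V) := by
    rw [← mul_assoc, h1, sub_mul, mul_assoc, h3]
    noncomm_ring
  rw [swapOp, sub_mul 1, mul_sub (ann y) 1, h4, mul_assoc, h2]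
  noncomm_ring

theorem swapOp_comm {V : Type} [Fintype V] [DecidableEq V] (x y : V) :
    (swapOp x y : FockOp V) = swapOp y x := by
  unfold swapOp
  noncomm_ring

theorem swapOp_mul_ann_of_ne {V : Type} [Fintype V] [DecidableEq V] (x y z : V) (hx : z ≠ x)
    (hy : z ≠ y) : swapOp x y * ann z = (ann z * swapOp x y : FockOp V) := by
  have h1 : ann z * (cre x - cre y) = (-((cre x - cre y) * ann z) : FockOp V) := by
    rw [mul_sub, ann_mul_cre z x hx, ann_mul_cre z y hy]
    noncomm_ring
  have h2 : ann z * (ann x - ann y) = (-((ann x - ann y) * ann z) : FockOp V) := by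
    rw [mul_sub, ann_mul_ann z x, ann_mul_ann z y]
    noncomm_ring
  rw [swapOp, sub_mul 1, mul_sub (ann z) 1, ← mul_assoc (ann z), h1, neg_mul, mul_assoc,
    mul_assoc, h2]
  noncomm_ring

theorem swapOp_mul_self {V : Type} [Fintype V] [DecidableEq V] (x y : V) :
    swapOp x y * swapOp x y = (1 : FockOp V) := by
  by_cases hxy : x = y
  · subst hxy
    simp [swapOp]
  have h1 : (ann x - ann y) * (cre x - cre y) =
      (1 + 1 - (cre x - cre y) * (ann x - ann y) : FockOp V) := by
    rw [sub_mul, mul_sub, mul_sub, ann_mul_cre_self, ann_mul_cre_self, ann_mul_cre x y hxy,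
      ann_mul_cre y x (Ne.symm hxy)]
    noncomm_ring
  have h2 : (ann x - ann y) * (ann x - ann y) = (0 : FockOp V) := by
    rw [sub_mul, mul_sub, mul_sub, ann_sq, ann_sq, ann_mul_ann x y]
    noncomm_ring
  have h3 : (cre x - cre y) * (ann x - ann y) * ((cre x - cre y) * (ann x - ann y)) =
      ((cre x - cre y) * (ann x - ann y) + (cre x - cre y) * (ann x - ann y) : FockOp V) := by
    rw [mul_assoc, ← mul_assoc (ann x - ann y), h1, sub_mul (1 + 1), mul_assoc _ (ann x - ann y),
      h2, mul_zero, sub_zero, add_mul, one_mul, mul_add]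
  rw [swapOp, sub_mul 1, mul_sub ((cre x - cre y) * (ann x - ann y)) 1, one_mul, mul_one, h3]
  abel

theorem swapList_unitary {V : Type} [Fintype V] [DecidableEq V] (r : V → V) (l : List V) :
    ((l.map fun x => swapOp x (r x)).prod : FockOp V)ᴴ *
      (l.map fun x => swapOp x (r x)).prod = 1 := by
  induction l with
  | nil => simp
  | cons x l ih =>
    rw [List.map_cons, List.prod_cons, Matrix.conjTranspose_mul, swapOp_conjTranspose, mul_assoc,
      ← mul_assoc (swapOp x (r x)), swapOp_mul_self, one_mul, ih]

theorem swapList_mul_ann {V : Type} [Fintype V] [DecidableEq V] (r : V → V)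
    (hr : Function.Involutive r) (l : List V) (hl : l.Nodup) (hrl : ∀ x ∈ l, r x ∉ l) (z : V) :
    (l.map fun x => swapOp x (r x)).prod * ann z =
      (ann (if z ∈ l ∨ r z ∈ l then r z else z) *
        (l.map fun x => swapOp x (r x)).prod : FockOp V) := by
  induction l with
  | nil => simp
  | cons x l ih =>
    have hx : x ∉ l := (List.nodup_cons.mp hl).1
    have hrx : r x ∉ x :: l := hrl x List.mem_cons_self
    have hne : x ≠ r x := fun h => hrx (by rw [← h]; exact List.mem_cons_self)
    have hrx' : r x ∉ l := fun h => hrx (List.mem_cons_of_mem _ h)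
    have ih' := ih (List.nodup_cons.mp hl).2
      (fun y hy h => hrl y (List.mem_cons_of_mem _ hy) (List.mem_cons_of_mem _ h))
    rw [List.map_cons, List.prod_cons, mul_assoc, ih', ← mul_assoc]
    by_cases h : z ∈ l ∨ r z ∈ l
    · have h' : z ∈ x :: l ∨ r z ∈ x :: l :=
        h.imp (List.mem_cons_of_mem _) (List.mem_cons_of_mem _)
      have n1 : r z ≠ x := by
        rintro rfl
        rcases h with h | h
        · exact hrx' (by rwa [hr z])
        · exact hx h
      have n2 : r z ≠ r x := by
        intro e
        have e' := hr.injective e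
        subst e'
        exact h.elim hx hrx'
      rw [if_pos h, if_pos h', swapOp_mul_ann_of_ne _ _ _ n1 n2, mul_assoc]
    · rw [if_neg h]
      by_cases h1 : z = x
      · subst h1
        rw [if_pos (Or.inl List.mem_cons_self), swapOp_mul_ann _ _ hne, mul_assoc]
      · by_cases h2 : z = r x
        · subst h2
          rw [if_pos (Or.inr (by rw [hr x]; exact List.mem_cons_self)), swapOp_comm,
            swapOp_mul_ann _ _ hne.symm, hr x, mul_assoc]
        · have h' : ¬ (z ∈ x :: l ∨ r z ∈ x :: l) := by
            rintro (h' | h')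
            · rcases List.mem_cons.mp h' with h' | h'
              · exact h1 h'
              · exact h (Or.inl h')
            · rcases List.mem_cons.mp h' with h' | h'
              · exact h2 (by rw [← h', hr z])
              · exact h (Or.inr h')
          rw [if_neg h', swapOp_mul_ann_of_ne _ _ _ h1 h2, mul_assoc]

theorem reflectionUnitary_unitary {V : Type} [Fintype V] [DecidableEq V] (r : V → V)
    (s : Finset V) :
    (reflectionUnitary r s : FockOp V)ᴴ * reflectionUnitary r s = 1 :=
  swapList_unitary r s.toList

theorem reflectionUnitary_ann {V : Type} [Fintype V] [DecidableEq V] (r : V → V)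
    (hr : Function.Involutive r) (s : Finset V) (hs : ∀ x, r x ∈ s ↔ x ∉ s) (x : V) :
    (reflectionUnitary r s : FockOp V)ᴴ * ann x * reflectionUnitary r s = ann (r x) := by
  have h := swapList_mul_ann r hr s.toList s.nodup_toList
    (fun y hy h => by
      rw [Finset.mem_toList] at hy h
      exact (hs y).mp h hy) (r x)
  have h' : r x ∈ s.toList ∨ r (r x) ∈ s.toList := by
    rw [Finset.mem_toList, Finset.mem_toList, hr x, hs x]
    tauto
  rw [if_pos h', hr x] at h
  change reflectionUnitary r s * ann (r x) = ann x * reflectionUnitary r s at h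
  rw [mul_assoc, ← h, ← mul_assoc, reflectionUnitary_unitary, one_mul]

/-! ### The particle-hole transformation -/

/-- The unitary `τ` with `τ* a^±_x τ = a^∓_x` (see `particleHole_ann`): the product over all sites
of `a⁺_x + a⁻_x`, times a power of `(-1)^N`. -/
noncomputable def particleHole (V : Type) [Fintype V] [DecidableEq V] : FockOp V :=
  ((Finset.univ : Finset V).toList.map fun x => ann x + cre x).prod *
    parity V ^ (Fintype.card V + 1)

theorem majorana_mul_self {V : Type} [Fintype V] [DecidableEq V] (x : V) :
    (ann x + cre x) * (ann x + cre x) = (1 : FockOp V) := by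
  rw [add_mul, mul_add, mul_add, ann_sq, cre_sq, ann_mul_cre_self]
  noncomm_ring

theorem majoranaList_unitary {V : Type} [Fintype V] [DecidableEq V] (l : List V) :
    ((l.map fun x => ann x + cre x).prod : FockOp V)ᴴ *
      (l.map fun x => ann x + cre x).prod = 1 := by
  induction l with
  | nil => simp
  | cons x l ih =>
    have hx : (ann x + cre x : FockOp V)ᴴ = ann x + cre x := by
      rw [Matrix.conjTranspose_add, cre_conjTranspose, add_comm]
      rfl
    rw [List.map_cons, List.prod_cons, Matrix.conjTranspose_mul, hx, mul_assoc,
      ← mul_assoc (ann x + cre x), majorana_mul_self, one_mul, ih]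

theorem majoranaList_mul_ann {V : Type} [Fintype V] [DecidableEq V] (l : List V) (hl : l.Nodup)
    (z : V) :
    (l.map fun x => ann x + cre x).prod * ann z =
      ((-1 : ℂ) ^ l.length • ((if z ∈ l then - cre z else ann z) *
        (l.map fun x => ann x + cre x).prod) : FockOp V) := by
  induction l with
  | nil => simp
  | cons x l ih =>
    have hx : x ∉ l := (List.nodup_cons.mp hl).1
    rw [List.map_cons, List.prod_cons, mul_assoc, ih (List.nodup_cons.mp hl).2,
      mul_smul_comm, ← mul_assoc, ← mul_assoc, List.length_cons, pow_succ, mul_smul]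
    congr 1
    rw [neg_smul, one_smul, ← neg_mul]
    congr 1
    by_cases h : z ∈ l
    · have hne : x ≠ z := by
        rintro rfl
        exact hx h
      rw [if_pos h, if_pos (List.mem_cons_of_mem _ h), mul_neg, add_mul, neg_mul, neg_neg,
        mul_add, ann_mul_cre x z hne, cre_mul_cre x z]
      abel
    · rw [if_neg h]
      by_cases h1 : z = x
      · subst h1
        rw [if_pos List.mem_cons_self, add_mul, ann_sq, neg_mul, neg_neg, mul_add, cre_sq]
        abel
      · have h' : z ∉ x :: l := by
          simp [h, h1]
        have hne : x ≠ z := fun e => h1 e.symm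
        rw [if_neg h', add_mul, mul_add, ann_mul_ann x z, cre_mul_ann x z hne]
        abel

theorem parity_pow_mul_ann {V : Type} [Fintype V] [DecidableEq V] (n : ℕ) (x : V) :
    parity V ^ n * ann x = (-1 : ℂ) ^ n • (ann x * parity V ^ n) := by
  induction n with
  | zero => simp
  | succ n ih =>
    rw [pow_succ, mul_assoc, parity_mul_ann, mul_neg, ← mul_assoc, ih, pow_succ, mul_smul,
      neg_smul, one_smul, smul_mul_assoc, mul_assoc, smul_neg]

theorem particleHole_unitary (V : Type) [Fintype V] [DecidableEq V] :
    (particleHole V)ᴴ * particleHole V = 1 := by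
  rw [particleHole, Matrix.conjTranspose_mul, mul_assoc, ← mul_assoc _ _ (parity V ^ _),
    majoranaList_unitary, one_mul, Matrix.conjTranspose_pow, parity_conjTranspose,
    ← (Commute.refl (parity V)).mul_pow, parity_mul_parity, one_pow]

theorem particleHole_cre {V : Type} [Fintype V] [DecidableEq V] (x : V) :
    (particleHole V)ᴴ * cre x * particleHole V = ann x := by
  have h : particleHole V * ann x = cre x * particleHole V := by
    have hs : (-1 : ℂ) ^ (Fintype.card V + 1) * (-1) ^ Fintype.card V = -1 := by
      rw [pow_succ, mul_assoc, neg_one_mul, mul_neg, ← mul_pow]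
      simp
    rw [particleHole, mul_assoc, parity_pow_mul_ann, mul_smul_comm, ← mul_assoc,
      majoranaList_mul_ann _ (Finset.nodup_toList _), if_pos (by simp), Finset.length_toList,
      Finset.card_univ, smul_mul_assoc, smul_smul, hs, neg_mul, neg_mul, smul_neg, neg_smul,
      neg_neg, one_smul, mul_assoc]
  rw [mul_assoc, ← h, ← mul_assoc, particleHole_unitary, one_mul]

theorem particleHole_ann {V : Type} [Fintype V] [DecidableEq V] (x : V) :
    (particleHole V)ᴴ * ann x * particleHole V = cre x := by
  have h := congrArg Matrix.conjTranspose (particleHole_cre x)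
  rw [Matrix.conjTranspose_mul, Matrix.conjTranspose_mul, cre_conjTranspose,
    Matrix.conjTranspose_conjTranspose, ← mul_assoc] at h
  exact h

/-! ### The antilinear reflection -/

/-- `Θ(O)`: the complex conjugate of `τ* R* O R τ`. The matrices of `a^±_x` are real, so the
conjugation acts on the coefficients of the monomials in `a^±_x`. -/
noncomputable def reflect {V : Type} [Fintype V] [DecidableEq V] (r : V → V) (s : Finset V)
    (O : FockOp V) : FockOp V :=
  ((particleHole V)ᴴ * (reflectionUnitary r s)ᴴ * O * reflectionUnitary r s *
    particleHole V).map (starRingEnd ℂ)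

theorem reflect_ann {V : Type} [Fintype V] [DecidableEq V] (r : V → V)
    (hr : Function.Involutive r) (s : Finset V) (hs : ∀ x, r x ∈ s ↔ x ∉ s) (x : V) :
    reflect r s (ann x) = cre (r x) := by
  have h := reflectionUnitary_ann r hr s hs x
  rw [reflect, mul_assoc (particleHole V)ᴴ, mul_assoc (particleHole V)ᴴ, h, particleHole_ann,
    cre_map_conj]

theorem reflect_conjTranspose {V : Type} [Fintype V] [DecidableEq V] (r : V → V) (s : Finset V)
    (O : FockOp V) : reflect r s Oᴴ = (reflect r s O)ᴴ := by
  have h : ((particleHole V)ᴴ * (reflectionUnitary r s)ᴴ * Oᴴ * reflectionUnitary r s *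
      particleHole V) = ((particleHole V)ᴴ * (reflectionUnitary r s)ᴴ * O *
        reflectionUnitary r s * particleHole V)ᴴ := by
    simp only [Matrix.conjTranspose_mul, Matrix.conjTranspose_conjTranspose, mul_assoc]
  rw [reflect, h, reflect]
  ext T S
  rfl

theorem reflect_mul {V : Type} [Fintype V] [DecidableEq V] (r : V → V) (s : Finset V)
    (A B : FockOp V) : reflect r s (A * B) = reflect r s A * reflect r s B := by
  have key : ∀ P R : FockOp V, P * Pᴴ = 1 → R * Rᴴ = 1 →
      Pᴴ * Rᴴ * (A * B) * R * P = (Pᴴ * Rᴴ * A * R * P) * (Pᴴ * Rᴴ * B * R * P) := by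
    intro P R hP hR
    calc Pᴴ * Rᴴ * (A * B) * R * P = Pᴴ * Rᴴ * A * 1 * B * R * P := by
          simp only [mul_assoc, mul_one]
      _ = Pᴴ * Rᴴ * A * (R * (P * Pᴴ) * Rᴴ) * B * R * P := by rw [hP, mul_one R, hR]
      _ = _ := by simp only [mul_assoc]
  have h := key (particleHole V) (reflectionUnitary r s)
    (mul_eq_one_comm.mp (particleHole_unitary V))
    (mul_eq_one_comm.mp (reflectionUnitary_unitary r s))
  rw [reflect, h, Matrix.map_mul, reflect, reflect]

theorem reflect_add {V : Type} [Fintype V] [DecidableEq V] (r : V → V) (s : Finset V)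
    (A B : FockOp V) : reflect r s (A + B) = reflect r s A + reflect r s B := by
  unfold reflect
  rw [mul_add, add_mul, add_mul, Matrix.map_add _ (fun a b => map_add _ a b)]

theorem reflect_smul {V : Type} [Fintype V] [DecidableEq V] (r : V → V) (s : Finset V) (c : ℂ)
    (A : FockOp V) : reflect r s (c • A) = starRingEnd ℂ c • reflect r s A := by
  unfold reflect
  rw [mul_smul_comm, smul_mul_assoc, smul_mul_assoc]
  ext T S
  rw [Matrix.map_apply, Matrix.smul_apply, Matrix.smul_apply, Matrix.map_apply, smul_eq_mul,
    smul_eq_mul, map_mul]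

/-! ### The torus cut into two halves -/

/-- The sites of the torus `Γ_L = ℤ² / L ℤ²`. -/
abbrev Site (L : ℕ) : Type := Fin 2 → ZMod L

/-- The nearest neighbour `x + e_μ` of `x`. -/
def shift {L : ℕ} (μ : Fin 2) (x : Site L) : Site L := x + Pi.single μ 1

/-- The left half of the torus: the `L / 2` consecutive lines `x_μ = c, …, c + L / 2 - 1`
orthogonal to `e_μ`. -/
def leftHalf {L : ℕ} [NeZero L] (μ : Fin 2) (c : ZMod L) : Finset (Site L) :=
  Finset.univ.filter fun x => (x μ - c).val < L / 2

/-- The right half of the torus. -/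
def rightHalf {L : ℕ} [NeZero L] (μ : Fin 2) (c : ZMod L) : Finset (Site L) :=
  (leftHalf μ c)ᶜ

/-- The geometric reflection `r` across the cut. It maps the line `x_μ = c + j` to the line
`x_μ = c - 1 - j`. -/
def siteReflection {L : ℕ} (μ : Fin 2) (c : ZMod L) (x : Site L) : Site L :=
  Function.update x μ (2 * c - 1 - x μ)

theorem siteReflection_involutive {L : ℕ} (μ : Fin 2) (c : ZMod L) :
    Function.Involutive (siteReflection μ c) := by
  intro x
  simp [siteReflection]

theorem siteReflection_mem {L : ℕ} [NeZero L] (hL : Even L) (μ : Fin 2) (c : ZMod L)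
    (x : Site L) : siteReflection μ c x ∈ leftHalf μ c ↔ x ∉ leftHalf μ c := by
  have hL0 : L ≠ 0 := NeZero.ne L
  obtain ⟨ℓ, hℓ⟩ := hL
  have hlt := ZMod.val_lt (x μ - c)
  have key : (2 * c - 1 - x μ - c).val = L - 1 - (x μ - c).val := by
    have h1 : 2 * c - 1 - x μ - c = ((L - 1 - (x μ - c).val : ℕ) : ZMod L) := by
      rw [Nat.cast_sub (by omega), Nat.cast_sub (by omega), ZMod.natCast_zmod_val,
        ZMod.natCast_self]
      push_cast
      ring
    rw [h1, ZMod.val_natCast, Nat.mod_eq_of_lt (by omega)]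
  simp only [leftHalf, Finset.mem_filter, Finset.mem_univ, true_and, siteReflection,
    Function.update_self, key]
  omega

/-- The hopping terms across the cut, with hopping amplitude `-t`:
`-t ∑ (a⁺_x a⁻_{x+e_μ} + a⁺_{x+e_μ} a⁻_x)` over the bonds `(x, x + e_μ)` that join the two halves. -/
noncomputable def cutHopping {L : ℕ} [NeZero L] (μ : Fin 2) (c : ZMod L) (t : ℝ) :
    FockOp (Site L) :=
  -(t : ℂ) • ∑ x with (x ∈ leftHalf μ c ∧ shift μ x ∈ rightHalf μ c) ∨
      (x ∈ rightHalf μ c ∧ shift μ x ∈ leftHalf μ c),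
    (cre x * ann (shift μ x) + cre (shift μ x) * ann x)

/-- The reflection operator `Θ` of the cut torus. -/
noncomputable def theta {L : ℕ} [NeZero L] (μ : Fin 2) (c : ZMod L) (O : FockOp (Site L)) :
    FockOp (Site L) :=
  reflect (siteReflection μ c) (leftHalf μ c) O

theorem theta_ann {L : ℕ} [NeZero L] (hL : Even L) (μ : Fin 2) (c : ZMod L) (x : Site L) :
    theta μ c (ann x) = cre (siteReflection μ c x) :=
  reflect_ann _ (siteReflection_involutive μ c) _ (siteReflection_mem hL μ c) x

theorem theta_cre {L : ℕ} [NeZero L] (hL : Even L) (μ : Fin 2) (c : ZMod L) (x : Site L) :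
    theta μ c (cre x) = ann (siteReflection μ c x) := by
  have h := theta_ann hL μ c x
  rw [theta] at h ⊢
  rw [cre, reflect_conjTranspose, h, cre_conjTranspose]

/-- The even partition function at half filling (chemical potential `0`) of
`H = H₁ + H₂ + V_int`: `Tr exp(-β H)`. -/
noncomputable def evenZ {L : ℕ} [NeZero L] (μ : Fin 2) (c : ZMod L) (t β : ℝ)
    (H₁ H₂ : FockOp (Site L)) : ℂ :=
  (NormedSpace.exp (-(β : ℂ) • (H₁ + H₂ + cutHopping μ c t))).trace

/-- The odd partition function at half filling of `H = H₁ + H₂ + V_int`: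
`Tr (-1)^N exp(-β H)`. -/
noncomputable def oddZ {L : ℕ} [NeZero L] (μ : Fin 2) (c : ZMod L) (t β : ℝ)
    (H₁ H₂ : FockOp (Site L)) : ℂ :=
  (parity (Site L) * NormedSpace.exp (-(β : ℂ) • (H₁ + H₂ + cutHopping μ c t))).trace

end LatticeFermion

open LatticeFermion

namespace LatticeFermion

/-! ### Powers converging to the exponential -/

/-! This is reflection positivity. If `θ` is antilinear and multiplicative and sends the left
algebra into its commutant, and `Tr (A θ(B)) · Tr 1 = Tr A · conj (Tr B)`, then `∑ Fᵢ θ(Fᵢ)` has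
nonnegative trace, and Cauchy-Schwarz bounds `|Tr ∑ Fᵢ θ(Gᵢ)|²` by the product of the two diagonal
traces. Such families are closed under sums, nonnegative multiples and products; the last because
`θ(G)` commutes with `F'`.

For fermions `Θ` itself does not qualify, since odd operators on opposite halves anticommute.
Conjugating `Θ` with `(-1)^{N(N+1)/2}` attaches a factor `(-1)^N` to the reflected generators, which
restores commutation (`twistedReflect_commute`). The twist is invisible on number-conserving
operators, so `θ(Hl) = Θ(Hl)` and `Hr = θ(Θ(Hr))`. The trace formula is `trace_mul_eq_of_commute`,
proved by averaging over Majorana operators and irreducibility of the Fock representation.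

With `P = (-1)^{N_l}`, every hopping term across the cut is `F θ(F)` for `F = a^±_x P`, and it
enters `-β V_int` with coefficient `βt ≥ 0`. The exponential is the limit of `n`-th powers of
first-order factors of the admissible form, so the inequality passes to the limit
(`trace_exp_sq_le`). The odd case costs nothing more: the left half has an even number of sites,
hence `(-1)^N = P θ(P)` is admissible as well. -/

theorem norm_pow_sub_pow_le {A : Type*} [NormedRing A] [NormOneClass A] {a b : A} {K : ℝ}
    (hK : 1 ≤ K) (ha : ‖a‖ ≤ K) (hb : ‖b‖ ≤ K) (n : ℕ) :
    ‖a ^ n - b ^ n‖ ≤ n * K ^ n * ‖a - b‖ := by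
  induction n with
  | zero => simp
  | succ n ih =>
    have hK0 : (0 : ℝ) ≤ K := zero_le_one.trans hK
    -- Telescoping. Since `K ≥ 1`, the bound may carry `K ^ n` in place of the sharper `K ^ (n -
    -- 1)`.
    have h1 : a ^ (n + 1) - b ^ (n + 1) = a ^ n * (a - b) + (a ^ n - b ^ n) * b := by
      rw [pow_succ, pow_succ]
      noncomm_ring
    have h2 : ‖a ^ n * (a - b)‖ ≤ K ^ (n + 1) * ‖a - b‖ := by
      refine (norm_mul_le _ _).trans (mul_le_mul_of_nonneg_right ?_ (norm_nonneg _))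
      calc ‖a ^ n‖ ≤ ‖a‖ ^ n := norm_pow_le a n
        _ ≤ K ^ n := pow_le_pow_left₀ (norm_nonneg _) ha n
        _ ≤ K ^ (n + 1) := pow_le_pow_right₀ hK n.le_succ
    have h3 : ‖(a ^ n - b ^ n) * b‖ ≤ n * K ^ n * ‖a - b‖ * K :=
      (norm_mul_le _ _).trans (mul_le_mul ih hb (norm_nonneg _) (by positivity))
    calc ‖a ^ (n + 1) - b ^ (n + 1)‖ ≤ K ^ (n + 1) * ‖a - b‖ + n * K ^ n * ‖a - b‖ * K := by
          rw [h1]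
          exact (norm_add_le _ _).trans (add_le_add h2 h3)
      _ = _ := by
          push_cast
          ring

theorem eventually_norm_le_one_add {A : Type*} [NormedRing A] [NormedAlgebra ℝ A]
    [NormOneClass A] {X : A} {M : ℕ → A}
    (hM : Filter.Tendsto (fun n : ℕ => (n : ℝ) • (M n - 1)) Filter.atTop (nhds X)) :
    ∀ᶠ n : ℕ in Filter.atTop, ‖M n‖ ≤ Real.exp ((‖X‖ + 1) / n) := by
  have h := hM.norm.eventually (gt_mem_nhds (lt_add_one ‖X‖))
  filter_upwards [h, Filter.eventually_gt_atTop 0] with n hn hn0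
  have hn' : (0 : ℝ) < n := by exact_mod_cast hn0
  rw [norm_smul, Real.norm_of_nonneg hn'.le] at hn
  have h1 : ‖M n - 1‖ ≤ (‖X‖ + 1) / n := by
    rw [le_div_iff₀ hn']
    linarith
  calc ‖M n‖ = ‖(M n - 1) + 1‖ := by rw [sub_add_cancel]
    _ ≤ ‖M n - 1‖ + 1 := by
        refine (norm_add_le _ _).trans ?_
        rw [norm_one]
    _ ≤ (‖X‖ + 1) / n + 1 := by linarith
    _ ≤ _ := Real.add_one_le_exp _

/-- Both norms are at most `K = exp ((‖X‖ + 1) / n)`, so the factor `K ^ n` in the telescoping bound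
does not depend on `n`, while `n ‖M n - N n‖` tends to `0` because both rescaled sequences have the
limit `X`. -/
theorem tendsto_pow_sub_pow {A : Type*} [NormedRing A] [NormedAlgebra ℝ A] [NormOneClass A]
    {X : A} {M N : ℕ → A}
    (hM : Filter.Tendsto (fun n : ℕ => (n : ℝ) • (M n - 1)) Filter.atTop (nhds X))
    (hN : Filter.Tendsto (fun n : ℕ => (n : ℝ) • (N n - 1)) Filter.atTop (nhds X)) :
    Filter.Tendsto (fun n : ℕ => M n ^ n - N n ^ n) Filter.atTop (nhds 0) := by
  have hd : Filter.Tendsto (fun n : ℕ => Real.exp (‖X‖ + 1) *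
      ‖(n : ℝ) • (M n - 1) - (n : ℝ) • (N n - 1)‖) Filter.atTop (nhds 0) := by
    have h := ((hM.sub hN).norm).const_mul (Real.exp (‖X‖ + 1))
    simpa using h
  refine squeeze_zero_norm' ?_ hd
  filter_upwards [eventually_norm_le_one_add hM, eventually_norm_le_one_add hN,
    Filter.eventually_gt_atTop 0] with n h1 h2 hn0
  have hn' : (0 : ℝ) < n := by exact_mod_cast hn0
  have hK : 1 ≤ Real.exp ((‖X‖ + 1) / n) := Real.one_le_exp (by positivity)
  refine (norm_pow_sub_pow_le hK h1 h2 n).trans (le_of_eq ?_)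
  rw [← smul_sub, sub_sub_sub_cancel_right, norm_smul, Real.norm_of_nonneg hn'.le,
    ← Real.exp_nat_mul, mul_div_cancel₀ _ hn'.ne']
  ring

/-- If `n (M n - 1) → X` then `(M n) ^ n → exp X`. -/
theorem tendsto_pow_exp {A : Type*} [NormedRing A] [NormedAlgebra ℝ A] [NormOneClass A]
    [CompleteSpace A] {X : A} {M : ℕ → A}
    (hM : Filter.Tendsto (fun n : ℕ => (n : ℝ) • (M n - 1)) Filter.atTop (nhds X)) :
    Filter.Tendsto (fun n : ℕ => M n ^ n) Filter.atTop (nhds (NormedSpace.exp X)) := by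
  let _ : NormedAlgebra ℚ A := NormedAlgebra.restrictScalars ℚ ℝ A
  -- The comparison sequence is `exp (X / n)`, whose `n`-th power is exactly `exp X`; its
  -- first-order behaviour is the derivative of `t ↦ exp (t X)` at `0`.
  have hN : Filter.Tendsto (fun n : ℕ => (n : ℝ) • (NormedSpace.exp ((n : ℝ)⁻¹ • X) - 1))
      Filter.atTop (nhds X) := by
    have h := hasDerivAt_exp_smul_const (𝕂 := ℝ) X (0 : ℝ)
    rw [zero_smul, NormedSpace.exp_zero, one_mul, hasDerivAt_iff_tendsto_slope] at h
    have h2 : Filter.Tendsto (fun n : ℕ => ((n : ℝ))⁻¹) Filter.atTop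
        (nhdsWithin 0 {0}ᶜ) := by
      refine tendsto_nhdsWithin_iff.mpr ⟨tendsto_inv_atTop_nhds_zero_nat, ?_⟩
      filter_upwards [Filter.eventually_gt_atTop 0] with n hn
      simpa using hn.ne'
    refine (h.comp h2).congr fun n => ?_
    simp [slope_def_module]
  have h := (tendsto_pow_sub_pow hM hN).add_const (NormedSpace.exp X)
  rw [zero_add] at h
  refine h.congr' ?_
  filter_upwards [Filter.eventually_gt_atTop 0] with n hn
  have hn' : (n : ℝ) ≠ 0 := by exact_mod_cast hn.ne'
  rw [← NormedSpace.exp_nsmul, ← Nat.cast_smul_eq_nsmul ℝ n, smul_smul, mul_inv_cancel₀ hn',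
    one_smul, sub_add_cancel]

/-! ### Parity of a set of sites -/

/-- The parity operator `(-1)^{N_s}` of the particles in `s`. -/
noncomputable def parityOn {V : Type} [DecidableEq V] (s : Finset V) : FockOp V :=
  Matrix.diagonal fun S => (-1) ^ (S ∩ s).card

theorem parityOn_empty {V : Type} [DecidableEq V] : parityOn (∅ : Finset V) = 1 := by
  simp [parityOn]

theorem cre_mul_ann_self {V : Type} [Fintype V] [DecidableEq V] (x : V) :
    (cre x * ann x : FockOp V) = Matrix.diagonal fun S => if x ∈ S then 1 else 0 := by
  ext T S
  rw [mul_ann_apply, cre_apply, Matrix.diagonal_apply]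
  by_cases hx : x ∈ S
  · by_cases h : T = S
    · simp [hx, h, orderSign_erase_self, orderSign_mul_self]
    · simp [hx, h]
  · by_cases h : T = S
    · simp [hx, h]
    · simp [hx, h]

/-- The new factor is `(-1)^{n_x} = 1 - 2 n_x`. This recursion exhibits the parity of a region as a
polynomial in the operators of that region. -/
theorem parityOn_insert {V : Type} [Fintype V] [DecidableEq V] (x : V) (s : Finset V)
    (hx : x ∉ s) : parityOn (insert x s) = (1 - (cre x * ann x + cre x * ann x)) * parityOn s := by
  rw [cre_mul_ann_self, Matrix.diagonal_add, ← Matrix.diagonal_one, Matrix.diagonal_sub,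
    parityOn, parityOn, Matrix.diagonal_mul_diagonal]
  congr 1
  funext S
  by_cases h : x ∈ S
  · rw [Finset.inter_insert_of_mem h, Finset.card_insert_of_notMem (by simp [hx]), if_pos h]
    ring
  · rw [Finset.inter_insert_of_notMem h, if_neg h]
    ring

theorem parityOn_mul_self {V : Type} [Fintype V] [DecidableEq V] (s : Finset V) :
    parityOn s * parityOn s = 1 := by
  rw [parityOn, Matrix.diagonal_mul_diagonal, ← Matrix.diagonal_one]
  congr 1
  funext S
  rw [← mul_pow]
  norm_num

theorem parityOn_mul_compl {V : Type} [Fintype V] [DecidableEq V] (s : Finset V) :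
    parityOn s * parityOn sᶜ = parity V := by
  rw [parityOn, parityOn, parity, Matrix.diagonal_mul_diagonal]
  congr 1
  funext S
  rw [← pow_add]
  congr 1
  rw [← Finset.card_union_of_disjoint, ← Finset.inter_union_distrib_left,
    Finset.union_compl, Finset.inter_univ]
  exact (disjoint_compl_right (a := s)).mono Finset.inter_subset_right Finset.inter_subset_right

theorem parityOn_conjTranspose {V : Type} [DecidableEq V] (s : Finset V) :
    (parityOn s : FockOp V)ᴴ = parityOn s := by
  rw [parityOn, Matrix.diagonal_conjTranspose]
  congr 1
  funext S
  simp

theorem parityOn_mul_ann_of_notMem {V : Type} [Fintype V] [DecidableEq V] (s : Finset V) (x : V)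
    (hx : x ∉ s) : parityOn s * ann x = ann x * parityOn s := by
  ext T S
  rw [parityOn, Matrix.diagonal_mul, Matrix.mul_diagonal, ann_apply]
  split_ifs with h
  · rw [h.2, Finset.erase_inter, Finset.erase_eq_of_notMem (by simp [hx])]
    ring
  · simp

theorem ann_mem_localAlgebra {V : Type} [Fintype V] [DecidableEq V] {s : Finset V} {x : V}
    (hx : x ∈ s) : ann x ∈ localAlgebra s :=
  Algebra.subset_adjoin (Or.inl ⟨x, hx, rfl⟩)

theorem cre_mem_localAlgebra {V : Type} [Fintype V] [DecidableEq V] {s : Finset V} {x : V}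
    (hx : x ∈ s) : cre x ∈ localAlgebra s :=
  Algebra.subset_adjoin (Or.inr ⟨x, hx, rfl⟩)

theorem parityOn_mem_localAlgebra {V : Type} [Fintype V] [DecidableEq V] (s : Finset V) :
    parityOn s ∈ localAlgebra s := by
  suffices h : ∀ u ⊆ s, parityOn u ∈ localAlgebra s from h s subset_rfl
  intro u
  induction u using Finset.induction with
  | empty => intro _; rw [parityOn_empty]; exact one_mem _
  | insert x u hx ih =>
    intro hu
    rw [parityOn_insert x u hx]
    have hxs := hu (Finset.mem_insert_self x u)
    have h := mul_mem (cre_mem_localAlgebra hxs) (ann_mem_localAlgebra hxs)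
    exact mul_mem (sub_mem (one_mem _) (add_mem h h))
      (ih ((Finset.subset_insert x u).trans hu))

theorem parityOn_compl_commute {V : Type} [Fintype V] [DecidableEq V] {s : Finset V}
    {A : FockOp V} (hA : A ∈ localAlgebra s) : Commute (parityOn sᶜ) A := by
  induction hA using Algebra.adjoin_induction with
  | mem A hA =>
    have key : ∀ x ∈ s, Commute (parityOn sᶜ : FockOp V) (ann x) := fun x hx =>
      parityOn_mul_ann_of_notMem _ _ (by simpa using hx)
    rcases hA with ⟨x, hx, rfl⟩ | ⟨x, hx, rfl⟩
    · exact key x hx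
    · have h := congrArg Matrix.conjTranspose (key x hx).eq
      rw [Matrix.conjTranspose_mul, Matrix.conjTranspose_mul, parityOn_conjTranspose] at h
      exact h.symm
  | algebraMap r => exact Algebra.commute_algebraMap_right r _
  | add A B _ _ h1 h2 => exact h1.add_right h2
  | mul A B _ _ h1 h2 => exact h1.mul_right h2

/-! ### Factorization of the trace -/

theorem parity_mul_cre {V : Type} [Fintype V] [DecidableEq V] (x : V) :
    parity V * cre x = -(cre x * parity V) := by
  have h := congrArg Matrix.conjTranspose (parity_mul_ann x)
  rw [Matrix.conjTranspose_mul, Matrix.conjTranspose_neg, Matrix.conjTranspose_mul,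
    parity_conjTranspose] at h
  rw [cre, h, neg_neg]

/-- An operator which anticommutes with the generators of `localAlgebra s` commutes with this
algebra when multiplied by the parity. -/
theorem commute_mul_parity {V : Type} [Fintype V] [DecidableEq V] {s : Finset V} {D : FockOp V}
    (ha : ∀ x ∈ s, D * ann x = -(ann x * D)) (hc : ∀ x ∈ s, D * cre x = -(cre x * D))
    {A : FockOp V} (hA : A ∈ localAlgebra s) : Commute (D * parity V) A := by
  induction hA using Algebra.adjoin_induction with
  | mem A hA =>
    rcases hA with ⟨x, hx, rfl⟩ | ⟨x, hx, rfl⟩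
    · rw [Commute, SemiconjBy, mul_assoc, parity_mul_ann, mul_neg, ← mul_assoc, ← mul_assoc,
        ha x hx, neg_mul, neg_neg]
    · rw [Commute, SemiconjBy, mul_assoc, parity_mul_cre, mul_neg, ← mul_assoc, ← mul_assoc,
        hc x hx, neg_mul, neg_neg]
  | algebraMap r => exact Algebra.commute_algebraMap_right r _
  | add A B _ _ h1 h2 => exact h1.add_right h2
  | mul A B _ _ h1 h2 => exact h1.mul_right h2

theorem ann_mul_parity_commute {V : Type} [Fintype V] [DecidableEq V] {s : Finset V} {y : V}
    (hy : y ∉ s) {A : FockOp V} (hA : A ∈ localAlgebra s) : Commute (ann y * parity V) A :=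
  commute_mul_parity (fun x _ => ann_mul_ann y x)
    (fun x hx => ann_mul_cre y x fun h => hy (h ▸ hx)) hA

theorem cre_mul_parity_commute {V : Type} [Fintype V] [DecidableEq V] {s : Finset V} {y : V}
    (hy : y ∉ s) {A : FockOp V} (hA : A ∈ localAlgebra s) : Commute (cre y * parity V) A :=
  commute_mul_parity (fun x hx => cre_mul_ann y x fun h => hy (h ▸ hx))
    (fun x _ => cre_mul_cre y x) hA

/-- The Fock representation is irreducible. -/
theorem eq_smul_one_of_commute {V : Type} [Fintype V] [DecidableEq V] (X : FockOp V)
    (ha : ∀ x, Commute X (ann x)) (hc : ∀ x, Commute X (cre x)) : ∃ k : ℂ, X = k • 1 := by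
  have hoff : ∀ T S : Finset V, T ≠ S → X T S = 0 := by
    intro T S hTS
    obtain ⟨x, hx⟩ : ∃ x, ¬ (x ∈ T ↔ x ∈ S) := by
      by_contra! h
      exact hTS (Finset.ext h)
    -- `X` commutes with the occupation number of `x`, which has different eigenvalues on `T` and
    -- `S`.
    have h := congrFun (congrFun ((hc x).mul_right (ha x)).eq T) S
    rw [cre_mul_ann_self, Matrix.mul_diagonal, Matrix.diagonal_mul] at h
    by_cases h1 : x ∈ T
    · have h2 : x ∉ S := fun h2 => hx (iff_of_true h1 h2)
      simpa [h1, h2] using h.symm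
    · have h2 : x ∈ S := by tauto
      simpa [h1, h2] using h
  have hdiag : ∀ S : Finset V, X S S = X ∅ ∅ := by
    intro S
    induction S using Finset.induction with
    | empty => rfl
    | insert x S hx ih =>
      -- The entry of `X a_x = a_x X` in row `S` and column `insert x S` compares two neighbouring
      -- diagonal entries of `X`.
      have h := congrFun (congrFun (ha x).eq S) (insert x S)
      have h0 : orderSign x (insert x S) ≠ 0 := fun h0 => by
        have := orderSign_mul_self x (insert x S)
        simp [h0] at this
      rw [mul_ann_apply, if_pos (Finset.mem_insert_self x S), Finset.erase_insert hx,
        Matrix.mul_apply, Finset.sum_eq_single (insert x S)] at h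
      · rw [ann_apply, if_pos ⟨Finset.mem_insert_self x S, (Finset.erase_insert hx).symm⟩,
          mul_comm] at h
        rw [← mul_left_cancel₀ h0 h, ih]
      · intro U _ hU
        rw [hoff U _ hU, mul_zero]
      · simp
  refine ⟨X ∅ ∅, ?_⟩
  ext T S
  by_cases h : T = S
  · subst h
    simp [hdiag]
  · simp [hoff T S h, h]

/-- The average of `A` and its conjugate by the involution `g`. -/
noncomputable def twirl {V : Type} [Fintype V] [DecidableEq V] (g A : FockOp V) : FockOp V :=
  (2⁻¹ : ℂ) • (A + g * A * g)

theorem twirl_commute_self {V : Type} [Fintype V] [DecidableEq V] {g : FockOp V} (hg : g * g = 1)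
    (A : FockOp V) : Commute (twirl g A) g := by
  refine Commute.smul_left ?_ _
  rw [Commute, SemiconjBy, add_mul, mul_add, mul_assoc (g * A), hg, mul_assoc g A g,
    ← mul_assoc g g, hg, one_mul, mul_one, add_comm]

/-- Moving `h` through `g A g` crosses `g` twice, so a sign from anticommutation cancels. Twirling
by a new involution therefore preserves the commutations already achieved. -/
theorem twirl_commute {V : Type} [Fintype V] [DecidableEq V] {g h A : FockOp V}
    (hgh : h * g = g * h ∨ h * g = -(g * h)) (hA : Commute A h) : Commute (twirl g A) h := by
  refine Commute.smul_left (Commute.add_left hA ?_) _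
  have hA' : A * h = h * A := hA
  have e1 : g * A * g * h = g * A * (g * h) := by rw [mul_assoc]
  have e2 : h * (g * A * g) = (h * g) * A * g := by simp only [mul_assoc]
  rw [Commute, SemiconjBy, e1, e2]
  rcases hgh with hgh | hgh
  · rw [← hgh, hgh, mul_assoc g h, ← hA', ← mul_assoc, ← mul_assoc, mul_assoc _ h, hgh]
    simp only [mul_assoc]
  · have e3 : g * h = -(h * g) := by rw [hgh, neg_neg]
    rw [hgh, neg_mul, neg_mul, mul_assoc g h, ← hA', e3, mul_neg]
    simp only [mul_assoc]

theorem trace_twirl_mul {V : Type} [Fintype V] [DecidableEq V] {g A B : FockOp V}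
    (hg : g * g = 1) (hB : Commute B g) : (twirl g A * B).trace = (A * B).trace := by
  have h : (g * A * g * B).trace = (A * B).trace := by
    rw [mul_assoc (g * A), ← hB.eq, mul_assoc, Matrix.trace_mul_comm, mul_assoc, mul_assoc, hg,
      mul_one]
  rw [twirl, smul_mul_assoc, add_mul, Matrix.trace_smul, Matrix.trace_add, h, smul_eq_mul]
  ring

/-- Twirling over a list of commuting or anticommuting involutions. -/
theorem exists_twirl {V : Type} [Fintype V] [DecidableEq V] (𝒜 : Subalgebra ℂ (FockOp V))
    (l : List (FockOp V)) (hl : ∀ g ∈ l, g ∈ 𝒜) (hsq : ∀ g ∈ l, g * g = 1)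
    (hc : ∀ g ∈ l, ∀ h ∈ l, h * g = g * h ∨ h * g = -(g * h)) (A : FockOp V) (hA : A ∈ 𝒜) :
    ∃ A' ∈ 𝒜, (∀ g ∈ l, Commute A' g) ∧
      ∀ B, (∀ g ∈ l, Commute B g) → (A' * B).trace = (A * B).trace := by
  induction l with
  | nil => exact ⟨A, hA, by simp, by simp⟩
  | cons g l ih =>
    obtain ⟨A', h1, h2, h3⟩ := ih (fun x hx => hl x (List.mem_cons_of_mem _ hx))
      (fun x hx => hsq x (List.mem_cons_of_mem _ hx))
      (fun x hx y hy => hc x (List.mem_cons_of_mem _ hx) y (List.mem_cons_of_mem _ hy))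
    have hg : g ∈ g :: l := List.mem_cons_self
    refine ⟨twirl g A', ?_, ?_, ?_⟩
    · exact 𝒜.smul_mem (add_mem h1 (mul_mem (mul_mem (hl g hg) h1) (hl g hg))) _
    · intro h hh
      rcases List.mem_cons.mp hh with rfl | hh'
      · exact twirl_commute_self (hsq _ hg) _
      · exact twirl_commute (hc g hg h hh) (h2 h hh')
    · intro B hB
      rw [trace_twirl_mul (hsq g hg) (hB g hg),
        h3 B fun x hx => hB x (List.mem_cons_of_mem _ hx)]

/-- The two Majorana operators at a site. -/
noncomputable def majorana {V : Type} [Fintype V] [DecidableEq V] (p : V × Bool) : FockOp V :=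
  if p.2 then ann p.1 + cre p.1 else Complex.I • (ann p.1 - cre p.1)

/-- Averaging needs involutions that pairwise commute or anticommute. The nilpotent `a^±_x` are not
involutions, but their Majorana combinations are, and they span the same space. -/
theorem majorana_sq {V : Type} [Fintype V] [DecidableEq V] (p : V × Bool) :
    majorana p * majorana p = (1 : FockOp V) := by
  obtain ⟨x, b⟩ := p
  cases b
  · simp only [majorana, Bool.false_eq_true, if_false]
    rw [smul_mul_smul_comm, Complex.I_mul_I, sub_mul, mul_sub, mul_sub, ann_sq, cre_sq,
      ann_mul_cre_self]
    simp
  · simpa [majorana] using majorana_mul_self x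

theorem majorana_comm {V : Type} [Fintype V] [DecidableEq V] (p q : V × Bool) :
    (majorana p * majorana q : FockOp V) = majorana q * majorana p ∨
      (majorana p * majorana q : FockOp V) = -(majorana q * majorana p) := by
  obtain ⟨x, b⟩ := p
  obtain ⟨y, b'⟩ := q
  by_cases hxy : x = y
  · subst hxy
    have h : (ann x + cre x) * (ann x - cre x) = (-((ann x - cre x) * (ann x + cre x)) : FockOp V) := by
      rw [add_mul, mul_sub, mul_sub, sub_mul, mul_add, mul_add, ann_sq, cre_sq]
      abel
    cases b <;> cases b'
    · exact Or.inl rfl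
    · right
      simp only [majorana, Bool.false_eq_true, if_false, if_true]
      rw [mul_smul_comm, h, smul_mul_assoc, smul_neg, neg_neg]
    · right
      simp only [majorana, Bool.false_eq_true, if_false, if_true]
      rw [mul_smul_comm, h, smul_mul_assoc, smul_neg]
    · exact Or.inl rfl
  · right
    have h1 := ann_mul_ann (V := V) x y
    have h2 := cre_mul_cre (V := V) x y
    have h3 := ann_mul_cre x y hxy
    have h4 := cre_mul_ann x y hxy
    -- Up to a scalar, both kinds of Majorana operator have the form `a_x + ε a⁺_x`, so general `ε`,
    -- `δ` cover all four cases.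
    have key : ∀ ε δ : ℂ, (ann x + ε • cre x) * (ann y + δ • cre y) =
        (-((ann y + δ • cre y) * (ann x + ε • cre x)) : FockOp V) := by
      intro ε δ
      simp only [add_mul, mul_add, smul_mul_assoc, mul_smul_comm, h1, h2, h3, h4]
      module
    have hm : ∀ (z : V) (b : Bool), ∃ k ε : ℂ, majorana (z, b) = k • (ann z + ε • cre z : FockOp V) := by
      intro z b
      cases b
      · exact ⟨Complex.I, -1, by simp [majorana, sub_eq_add_neg]⟩
      · exact ⟨1, 1, by simp [majorana]⟩
    obtain ⟨k, ε, hk⟩ := hm x b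
    obtain ⟨k', δ, hk'⟩ := hm y b'
    rw [hk, hk', smul_mul_smul_comm, smul_mul_smul_comm, key, smul_neg, mul_comm k]

theorem majorana_mem {V : Type} [Fintype V] [DecidableEq V] {s : Finset V} {p : V × Bool}
    (hp : p.1 ∈ s) : majorana p ∈ localAlgebra s := by
  have h1 := ann_mem_localAlgebra hp
  have h2 := cre_mem_localAlgebra hp
  unfold majorana
  split_ifs
  · exact add_mem h1 h2
  · exact Subalgebra.smul_mem _ (sub_mem h1 h2) _

theorem ann_eq_majorana {V : Type} [Fintype V] [DecidableEq V] (x : V) :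
    (ann x : FockOp V) = (2⁻¹ : ℂ) • (majorana (x, true) - Complex.I • majorana (x, false)) := by
  simp only [majorana, Bool.false_eq_true, if_false, if_true, smul_smul, Complex.I_mul_I]
  module

theorem cre_eq_majorana {V : Type} [Fintype V] [DecidableEq V] (x : V) :
    (cre x : FockOp V) = (2⁻¹ : ℂ) • (majorana (x, true) + Complex.I • majorana (x, false)) := by
  simp only [majorana, Bool.false_eq_true, if_false, if_true, smul_smul, Complex.I_mul_I]
  module

/-- Averaging `A` over the Majorana operators of `s` leaves `Tr (A B)` unchanged, since `B` commutes
with them, and replaces `A` by an element `A'` of the algebra that is central in it. Such an element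
also commutes with the generators outside `s`, hence is a scalar by irreducibility. -/
theorem trace_mul_eq_of_commute {V : Type} [Fintype V] [DecidableEq V] {s : Finset V}
    {A B : FockOp V} (hA : A ∈ localAlgebra s) (hB : ∀ C ∈ localAlgebra s, Commute B C) :
    (A * B).trace * (1 : FockOp V).trace = A.trace * B.trace := by
  obtain ⟨A', h1, h2, h3⟩ := exists_twirl (localAlgebra s)
    ((s ×ˢ (Finset.univ : Finset Bool)).toList.map majorana)
    (by
      intro g hg
      simp only [List.mem_map, Finset.mem_toList, Finset.mem_product] at hg
      obtain ⟨p, hp, rfl⟩ := hg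
      exact majorana_mem hp.1)
    (by
      intro g hg
      obtain ⟨p, hp, rfl⟩ := List.mem_map.mp hg
      exact majorana_sq p)
    (by
      intro g hg h hh
      obtain ⟨p, hp, rfl⟩ := List.mem_map.mp hg
      obtain ⟨q, hq, rfl⟩ := List.mem_map.mp hh
      exact majorana_comm q p) A hA
  have hm : ∀ x ∈ s, ∀ b, Commute A' (majorana (x, b)) := fun x hx b =>
    h2 _ (List.mem_map_of_mem (by simp [hx]))
  have hl : ∀ x ∈ s, Commute A' (ann x) ∧ Commute A' (cre x) := by
    intro x hx
    rw [ann_eq_majorana, cre_eq_majorana]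
    exact ⟨((hm x hx true).sub_right ((hm x hx false).smul_right _)).smul_right _,
      ((hm x hx true).add_right ((hm x hx false).smul_right _)).smul_right _⟩
  have hcomm : ∀ C ∈ localAlgebra s, Commute A' C := by
    intro C hC
    induction hC using Algebra.adjoin_induction with
    | mem C hC =>
      rcases hC with ⟨x, hx, rfl⟩ | ⟨x, hx, rfl⟩
      · exact (hl x hx).1
      · exact (hl x hx).2
    | algebraMap r => exact Algebra.commute_algebraMap_right r _
    | add A B _ _ h1 h2 => exact h1.add_right h2
    | mul A B _ _ h1 h2 => exact h1.mul_right h2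
  -- The total parity splits into the parity of `s`, which lies in the algebra, and that of the
  -- complement, which commutes with it. For a generator `D` outside `s`, `A'` commutes with `D
  -- (-1)^N`, so the parity can be removed.
  have hpar : Commute A' (parity V) := by
    rw [← parityOn_mul_compl s]
    exact (hcomm _ (parityOn_mem_localAlgebra s)).mul_right (parityOn_compl_commute h1).symm
  have hr : ∀ D : FockOp V, Commute (D * parity V) A' → Commute A' D := by
    intro D hD
    have h := hD.symm.mul_right hpar
    rwa [mul_assoc, parity_mul_parity, mul_one] at h
  obtain ⟨k, hk⟩ := eq_smul_one_of_commute A'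
    (fun x => by
      by_cases hx : x ∈ s
      · exact (hl x hx).1
      · exact hr _ (ann_mul_parity_commute hx h1))
    (fun x => by
      by_cases hx : x ∈ s
      · exact (hl x hx).2
      · exact hr _ (cre_mul_parity_commute hx h1))
  have hk' : ∀ B, (∀ C ∈ localAlgebra s, Commute B C) → (A * B).trace = k * B.trace := by
    intro B hB
    rw [← h3 B, hk, smul_mul_assoc, one_mul, Matrix.trace_smul, smul_eq_mul]
    intro g hg
    simp only [List.mem_map, Finset.mem_toList, Finset.mem_product] at hg
    obtain ⟨p, hp, rfl⟩ := hg
    exact hB _ (majorana_mem hp.1)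
  -- Taking `B = 1` identifies the scalar: `Tr A = k Tr 1`.
  have e := hk' 1 fun C _ => Commute.one_left C
  rw [mul_one] at e
  rw [hk' B hB, e]
  ring

/-! ### The twisted reflection -/

/-- The diagonal operator `(-1)^{N(N+1)/2}`. -/
noncomputable def kleinOp (V : Type) [DecidableEq V] : FockOp V :=
  Matrix.diagonal fun S => (-1) ^ (S.card + 1).choose 2

theorem kleinOp_mul_self (V : Type) [Fintype V] [DecidableEq V] :
    kleinOp V * kleinOp V = 1 := by
  rw [kleinOp, Matrix.diagonal_mul_diagonal, ← Matrix.diagonal_one]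
  congr 1
  funext S
  rw [← mul_pow]
  norm_num

theorem kleinOp_conjTranspose (V : Type) [DecidableEq V] : (kleinOp V)ᴴ = kleinOp V := by
  rw [kleinOp, Matrix.diagonal_conjTranspose]
  congr 1
  funext S
  simp

/-- With `n` the particle number before annihilation, the two signs differ by the exponent `n(n+1)/2
- (n-1)n/2 = n`, which is the parity. -/
theorem kleinOp_conj_ann {V : Type} [Fintype V] [DecidableEq V] (x : V) :
    kleinOp V * ann x * kleinOp V = ann x * parity V := by
  ext T S
  rw [kleinOp, parity, Matrix.mul_diagonal, Matrix.diagonal_mul, Matrix.mul_diagonal, ann_apply]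
  split_ifs with h
  · obtain ⟨h1, rfl⟩ := h
    rw [← Finset.card_erase_add_one h1, Nat.choose_succ_succ ((S.erase x).card + 1) 1,
      Nat.choose_one_right, pow_add]
    have h2 : ((-1 : ℂ) ^ ((S.erase x).card + 1).choose 2) *
        (-1) ^ ((S.erase x).card + 1).choose 2 = 1 := by
      rw [← mul_pow]
      norm_num
    linear_combination orderSign x S * (-1) ^ ((S.erase x).card + 1) * h2
  · simp

theorem kleinOp_conj_cre {V : Type} [Fintype V] [DecidableEq V] (x : V) :
    kleinOp V * cre x * kleinOp V = parity V * cre x := by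
  have h := congrArg Matrix.conjTranspose (kleinOp_conj_ann x)
  rw [Matrix.conjTranspose_mul, Matrix.conjTranspose_mul, Matrix.conjTranspose_mul,
    kleinOp_conjTranspose, parity_conjTranspose, ← mul_assoc] at h
  exact h

/-- The reflection, conjugated with `(-1)^{N(N+1)/2}`. It agrees with the reflection on operators
which conserve the particle number, and maps `localAlgebra s` into its commutant. -/
noncomputable def twistedReflect {V : Type} [Fintype V] [DecidableEq V] (r : V → V)
    (s : Finset V) (O : FockOp V) : FockOp V :=
  kleinOp V * reflect r s O * kleinOp V

theorem reflect_one {V : Type} [Fintype V] [DecidableEq V] (r : V → V) (s : Finset V) :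
    reflect r s (1 : FockOp V) = 1 := by
  have h : (particleHole V)ᴴ * (reflectionUnitary r s)ᴴ * 1 * reflectionUnitary r s *
      particleHole V = 1 := by
    rw [mul_one, mul_assoc (particleHole V)ᴴ, reflectionUnitary_unitary, mul_one,
      particleHole_unitary]
  rw [reflect, h]
  ext T S
  by_cases h : T = S <;> simp [h, Matrix.one_apply]

theorem reflect_cre {V : Type} [Fintype V] [DecidableEq V] (r : V → V)
    (hr : Function.Involutive r) (s : Finset V) (hs : ∀ x, r x ∈ s ↔ x ∉ s) (x : V) :
    reflect r s (cre x) = ann (r x) := by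
  rw [cre, reflect_conjTranspose, reflect_ann r hr s hs, cre_conjTranspose]

theorem trace_reflect {V : Type} [Fintype V] [DecidableEq V] (r : V → V) (s : Finset V)
    (O : FockOp V) : (reflect r s O).trace = starRingEnd ℂ O.trace := by
  have h : ((particleHole V)ᴴ * (reflectionUnitary r s)ᴴ * O * reflectionUnitary r s *
      particleHole V).trace = O.trace := by
    rw [Matrix.trace_mul_comm, ← mul_assoc, ← mul_assoc, ← mul_assoc,
      mul_eq_one_comm.mp (particleHole_unitary V), one_mul, Matrix.trace_mul_comm, ← mul_assoc,
      mul_eq_one_comm.mp (reflectionUnitary_unitary r s), one_mul]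
  rw [← h, reflect, Matrix.trace, Matrix.trace, map_sum]
  rfl

/-- `reflect` as an additive homomorphism. -/
noncomputable def reflectHom {V : Type} [Fintype V] [DecidableEq V] (r : V → V) (s : Finset V) :
    FockOp V →+ FockOp V :=
  AddMonoidHom.mk' (reflect r s) (reflect_add r s)

theorem reflect_sum {V ι : Type} [Fintype V] [DecidableEq V] (r : V → V) (s : Finset V)
    (t : Finset ι) (f : ι → FockOp V) :
    reflect r s (∑ i ∈ t, f i) = ∑ i ∈ t, reflect r s (f i) :=
  map_sum (reflectHom r s) f t

theorem reflect_sub {V : Type} [Fintype V] [DecidableEq V] (r : V → V) (s : Finset V)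
    (A B : FockOp V) : reflect r s (A - B) = reflect r s A - reflect r s B :=
  map_sub (reflectHom r s) A B

theorem reflect_algebraMap {V : Type} [Fintype V] [DecidableEq V] (r : V → V) (s : Finset V)
    (k : ℂ) : reflect r s (algebraMap ℂ (FockOp V) k) = algebraMap ℂ (FockOp V) (starRingEnd ℂ k) := by
  rw [Algebra.algebraMap_eq_smul_one, Algebra.algebraMap_eq_smul_one, reflect_smul, reflect_one]

theorem reflect_mem_localAlgebra {V : Type} [Fintype V] [DecidableEq V] {r : V → V}
    (hr : Function.Involutive r) {s : Finset V} (hs : ∀ x, r x ∈ s ↔ x ∉ s) {u v : Finset V}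
    (huv : ∀ x ∈ u, r x ∈ v) {A : FockOp V} (hA : A ∈ localAlgebra u) :
    reflect r s A ∈ localAlgebra v := by
  induction hA using Algebra.adjoin_induction with
  | mem A hA =>
    rcases hA with ⟨x, hx, rfl⟩ | ⟨x, hx, rfl⟩
    · rw [reflect_ann r hr s hs]
      exact cre_mem_localAlgebra (huv x hx)
    · rw [reflect_cre r hr s hs]
      exact ann_mem_localAlgebra (huv x hx)
  | algebraMap k =>
    rw [reflect_algebraMap]
    exact Subalgebra.algebraMap_mem _ _
  | add A B _ _ h1 h2 =>
    rw [reflect_add]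
    exact add_mem h1 h2
  | mul A B _ _ h1 h2 =>
    rw [reflect_mul]
    exact mul_mem h1 h2

/-- This allows an operator on the right half to be presented as the reflection of one on the left
half. -/
theorem reflect_reflect {V : Type} [Fintype V] [DecidableEq V] {r : V → V}
    (hr : Function.Involutive r) {s : Finset V} (hs : ∀ x, r x ∈ s ↔ x ∉ s) {u : Finset V}
    {A : FockOp V} (hA : A ∈ localAlgebra u) : reflect r s (reflect r s A) = A := by
  induction hA using Algebra.adjoin_induction with
  | mem A hA =>
    rcases hA with ⟨x, hx, rfl⟩ | ⟨x, hx, rfl⟩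
    · rw [reflect_ann r hr s hs, reflect_cre r hr s hs, hr x]
    · rw [reflect_cre r hr s hs, reflect_ann r hr s hs, hr x]
  | algebraMap k => rw [reflect_algebraMap, reflect_algebraMap, Complex.conj_conj]
  | add A B _ _ h1 h2 => rw [reflect_add, reflect_add, h1, h2]
  | mul A B _ _ h1 h2 => rw [reflect_mul, reflect_mul, h1, h2]

/-- Particles become holes. Since `N` only changes sign and shifts by a constant, conservation of
the particle number survives reflection. -/
theorem reflect_number {V : Type} [Fintype V] [DecidableEq V] {r : V → V}
    (hr : Function.Involutive r) {s : Finset V} (hs : ∀ x, r x ∈ s ↔ x ∉ s) :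
    reflect r s (number V) = (Fintype.card V : FockOp V) - number V := by
  rw [number, reflect_sum]
  have h : ∀ x : V, reflect r s (cre x * ann x) = 1 - cre (r x) * ann (r x) := by
    intro x
    rw [reflect_mul, reflect_cre r hr s hs, reflect_ann r hr s hs, ann_mul_cre_self]
  rw [Finset.sum_congr rfl fun x _ => h x, Finset.sum_sub_distrib,
    (hr.bijective).sum_comp (fun x => (cre x * ann x : FockOp V))]
  simp

theorem reflect_commute_number {V : Type} [Fintype V] [DecidableEq V] {r : V → V}
    (hr : Function.Involutive r) {s : Finset V} (hs : ∀ x, r x ∈ s ↔ x ∉ s) {A : FockOp V}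
    (hA : Commute A (number V)) : Commute (reflect r s A) (number V) := by
  have h := congrArg (reflect r s) hA.eq
  rw [reflect_mul, reflect_mul] at h
  have h' : Commute (reflect r s A) (reflect r s (number V)) := h
  rw [reflect_number hr hs] at h'
  have h2 := (Nat.commute_cast (reflect r s A) (Fintype.card V)).sub_right h'
  rwa [sub_sub_cancel] at h2

/-- An operator commuting with `N` has nonzero entries only between sets of equal cardinality, so it
commutes with every function of `N`. Applied to `kleinOp`, this makes the twist disappear on
number-conserving operators. -/
theorem commute_diagonal_card {V : Type} [Fintype V] [DecidableEq V] {A : FockOp V}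
    (hA : Commute A (number V)) (f : ℕ → ℂ) :
    Commute A (Matrix.diagonal fun S : Finset V => f S.card) := by
  ext T S
  have h := congrFun (congrFun hA.eq T) S
  rw [number_eq_diagonal, Matrix.mul_diagonal, Matrix.diagonal_mul] at h
  rw [Matrix.mul_diagonal, Matrix.diagonal_mul]
  by_cases hTS : T.card = S.card
  · rw [hTS, mul_comm]
  · have h0 : A T S * ((S.card : ℂ) - T.card) = 0 := by linear_combination h
    rcases mul_eq_zero.mp h0 with h1 | h1
    · rw [h1, zero_mul, mul_zero]
    · exact absurd (by exact_mod_cast (sub_eq_zero.mp h1).symm) hTS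

theorem twistedReflect_eq_reflect {V : Type} [Fintype V] [DecidableEq V] {r : V → V}
    (hr : Function.Involutive r) {s : Finset V} (hs : ∀ x, r x ∈ s ↔ x ∉ s) {A : FockOp V}
    (hA : Commute A (number V)) : twistedReflect r s A = reflect r s A := by
  have h : Commute (reflect r s A) (kleinOp V) :=
    commute_diagonal_card (reflect_commute_number hr hs hA) fun n => (-1) ^ (n + 1).choose 2
  rw [twistedReflect, ← h.eq, mul_assoc, kleinOp_mul_self, mul_one]

theorem twistedReflect_mul {V : Type} [Fintype V] [DecidableEq V] (r : V → V) (s : Finset V)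
    (A B : FockOp V) :
    twistedReflect r s (A * B) = twistedReflect r s A * twistedReflect r s B := by
  have h : ∀ D X Y : FockOp V, D * D = 1 → D * X * D * (D * Y * D) = D * (X * Y) * D := by
    intro D X Y hD
    calc D * X * D * (D * Y * D) = D * X * (D * D) * Y * D := by simp only [mul_assoc]
      _ = _ := by rw [hD, mul_one]; simp only [mul_assoc]
  rw [twistedReflect, reflect_mul, twistedReflect, twistedReflect, h _ _ _ (kleinOp_mul_self V)]

theorem twistedReflect_add {V : Type} [Fintype V] [DecidableEq V] (r : V → V) (s : Finset V)
    (A B : FockOp V) :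
    twistedReflect r s (A + B) = twistedReflect r s A + twistedReflect r s B := by
  rw [twistedReflect, reflect_add, mul_add, add_mul]
  rfl

theorem twistedReflect_smul {V : Type} [Fintype V] [DecidableEq V] (r : V → V) (s : Finset V)
    (k : ℂ) (A : FockOp V) :
    twistedReflect r s (k • A) = starRingEnd ℂ k • twistedReflect r s A := by
  rw [twistedReflect, reflect_smul, mul_smul_comm, smul_mul_assoc]
  rfl

theorem twistedReflect_one {V : Type} [Fintype V] [DecidableEq V] (r : V → V) (s : Finset V) :
    twistedReflect r s (1 : FockOp V) = 1 := by
  rw [twistedReflect, reflect_one, mul_one, kleinOp_mul_self]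

theorem trace_twistedReflect {V : Type} [Fintype V] [DecidableEq V] (r : V → V) (s : Finset V)
    (A : FockOp V) : (twistedReflect r s A).trace = starRingEnd ℂ A.trace := by
  rw [twistedReflect, Matrix.trace_mul_comm, ← mul_assoc, kleinOp_mul_self, one_mul,
    trace_reflect]

theorem twistedReflect_ann {V : Type} [Fintype V] [DecidableEq V] {r : V → V}
    (hr : Function.Involutive r) {s : Finset V} (hs : ∀ x, r x ∈ s ↔ x ∉ s) (x : V) :
    twistedReflect r s (ann x) = parity V * cre (r x) := by
  rw [twistedReflect, reflect_ann r hr s hs, kleinOp_conj_cre]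

theorem twistedReflect_cre {V : Type} [Fintype V] [DecidableEq V] {r : V → V}
    (hr : Function.Involutive r) {s : Finset V} (hs : ∀ x, r x ∈ s ↔ x ∉ s) (x : V) :
    twistedReflect r s (cre x) = ann (r x) * parity V := by
  rw [twistedReflect, reflect_cre r hr s hs, kleinOp_conj_ann]

/-- A reflected generator lives outside `s` and anticommutes with the generators of `s`; so does the
parity attached to it by the twist. The two signs cancel. -/
theorem twistedReflect_commute {V : Type} [Fintype V] [DecidableEq V] {r : V → V}
    (hr : Function.Involutive r) {s : Finset V} (hs : ∀ x, r x ∈ s ↔ x ∉ s) {A B : FockOp V}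
    (hA : A ∈ localAlgebra s) (hB : B ∈ localAlgebra s) : Commute (twistedReflect r s B) A := by
  induction hB using Algebra.adjoin_induction with
  | mem B hB =>
    have hrx : ∀ x ∈ s, r x ∉ s := fun x hx h => (hs x).mp h hx
    rcases hB with ⟨x, hx, rfl⟩ | ⟨x, hx, rfl⟩
    · rw [twistedReflect_ann hr hs, parity_mul_cre]
      exact (cre_mul_parity_commute (hrx x hx) hA).neg_left
    · rw [twistedReflect_cre hr hs]
      exact ann_mul_parity_commute (hrx x hx) hA
  | algebraMap k =>
    rw [Algebra.algebraMap_eq_smul_one, twistedReflect_smul, twistedReflect_one]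
    exact (Commute.one_left _).smul_left _
  | add B C _ _ h1 h2 =>
    rw [twistedReflect_add]
    exact h1.add_left h2
  | mul B C _ _ h1 h2 =>
    rw [twistedReflect_mul]
    exact h1.mul_left h2

/-- For `B = A` the right-hand side is `|Tr A|² ≥ 0`: the basic positivity. -/
theorem trace_mul_twistedReflect {V : Type} [Fintype V] [DecidableEq V] {r : V → V}
    (hr : Function.Involutive r) {s : Finset V} (hs : ∀ x, r x ∈ s ↔ x ∉ s) {A B : FockOp V}
    (hA : A ∈ localAlgebra s) (hB : B ∈ localAlgebra s) :
    (A * twistedReflect r s B).trace * (1 : FockOp V).trace =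
      A.trace * starRingEnd ℂ B.trace := by
  rw [trace_mul_eq_of_commute hA fun C hC => twistedReflect_commute hr hs hC hB,
    trace_twistedReflect]

/-- Reflection sends `n_x` to `1 - n_{r x}`, hence `1 - 2 n_x` to `-(1 - 2 n_{r x})`: one sign for
each site of `u`. -/
theorem twistedReflect_parityOn {V : Type} [Fintype V] [DecidableEq V] {r : V → V}
    (hr : Function.Involutive r) {s : Finset V} (hs : ∀ x, r x ∈ s ↔ x ∉ s) (u : Finset V) :
    twistedReflect r s (parityOn u) = (-1 : ℂ) ^ u.card • parityOn (u.image r) := by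
  induction u using Finset.induction with
  | empty => simp [parityOn_empty, twistedReflect_one]
  | insert x u hx ih =>
    have h1 : twistedReflect r s (1 - (cre x * ann x + cre x * ann x)) =
        (-1 : ℂ) • (1 - (cre (r x) * ann (r x) + cre (r x) * ann (r x))) := by
      have h2 : reflect r s (1 - (cre x * ann x + cre x * ann x)) =
          (-1 : ℂ) • (1 - (cre (r x) * ann (r x) + cre (r x) * ann (r x))) := by
        rw [reflect_sub, reflect_one, reflect_add, reflect_mul, reflect_cre r hr s hs,
          reflect_ann r hr s hs, ann_mul_cre_self]
        module
      have hN : Commute (cre x * ann x : FockOp V) (number V) := by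
        rw [cre_mul_ann_self, number_eq_diagonal]
        exact Matrix.commute_diagonal _ _
      rw [← h2]
      exact twistedReflect_eq_reflect hr hs
        ((Commute.one_left _).sub_left (hN.add_left hN))
    have hx' : r x ∉ u.image r := by
      simpa [hr.injective.eq_iff] using hx
    rw [parityOn_insert x u hx, twistedReflect_mul, h1, ih, Finset.image_insert,
      parityOn_insert _ _ hx', Finset.card_insert_of_notMem hx, smul_mul_smul_comm, pow_succ']

theorem image_eq_compl {V : Type} [Fintype V] [DecidableEq V] {r : V → V}
    (hr : Function.Involutive r) {s : Finset V} (hs : ∀ x, r x ∈ s ↔ x ∉ s) :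
    s.image r = sᶜ := by
  ext x
  rw [Finset.mem_image, Finset.mem_compl, ← hs x]
  constructor
  · rintro ⟨y, hy, rfl⟩
    rwa [hr y]
  · exact fun h => ⟨r x, h, hr x⟩

theorem twistedReflect_parityOn_self {V : Type} [Fintype V] [DecidableEq V] {r : V → V}
    (hr : Function.Involutive r) {s : Finset V} (hs : ∀ x, r x ∈ s ↔ x ∉ s)
    (hcard : Even s.card) : twistedReflect r s (parityOn s) = parityOn sᶜ := by
  rw [twistedReflect_parityOn hr hs, image_eq_compl hr hs, hcard.neg_one_pow, one_smul]

/-! ### Hopping terms as twisted squares -/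

theorem parityOn_mul_cre_of_notMem {V : Type} [Fintype V] [DecidableEq V] (s : Finset V) (x : V)
    (hx : x ∉ s) : parityOn s * cre x = cre x * parityOn s := by
  have h := congrArg Matrix.conjTranspose (parityOn_mul_ann_of_notMem s x hx)
  rw [Matrix.conjTranspose_mul, Matrix.conjTranspose_mul, parityOn_conjTranspose] at h
  exact h.symm

theorem parity_mul_parityOn_compl {V : Type} [Fintype V] [DecidableEq V] (s : Finset V) :
    parity V * parityOn sᶜ = parityOn s := by
  rw [← parityOn_mul_compl s, mul_assoc, parityOn_mul_self, mul_one]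

/-- `θ(a⁺_x) = a_{r x} (-1)^N` carries an unwanted global parity. With `P` the parity of `s`, `θ(P)`
is the parity of the complement and reduces `(-1)^N` to `P`, which cancels the `P` in the left
factor. -/
theorem cre_mul_ann_eq_twisted {V : Type} [Fintype V] [DecidableEq V] {r : V → V}
    (hr : Function.Involutive r) {s : Finset V} (hs : ∀ x, r x ∈ s ↔ x ∉ s)
    (hcard : Even s.card) {x : V} (hx : x ∈ s) :
    cre x * ann (r x) = cre x * parityOn s * twistedReflect r s (cre x * parityOn s) := by
  have hrx : r x ∉ s := fun h => (hs x).mp h hx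
  rw [twistedReflect_mul, twistedReflect_cre hr hs, twistedReflect_parityOn_self hr hs hcard,
    mul_assoc (ann (r x)), parity_mul_parityOn_compl, mul_assoc, ← mul_assoc (parityOn s),
    parityOn_mul_ann_of_notMem s _ hrx, mul_assoc (ann (r x)), parityOn_mul_self, mul_one]

/-- As for the other hopping direction; the sign from moving the parity past `a⁺_{r x}` compensates
the one from reordering `a_x` and `a⁺_{r x}`. -/
theorem cre_mul_ann_eq_twisted' {V : Type} [Fintype V] [DecidableEq V] {r : V → V}
    (hr : Function.Involutive r) {s : Finset V} (hs : ∀ x, r x ∈ s ↔ x ∉ s)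
    (hcard : Even s.card) {x : V} (hx : x ∈ s) :
    cre (r x) * ann x = ann x * parityOn s * twistedReflect r s (ann x * parityOn s) := by
  have hrx : r x ∉ s := fun h => (hs x).mp h hx
  have hne : r x ≠ x := fun h => hrx (h.symm ▸ hx)
  rw [twistedReflect_mul, twistedReflect_ann hr hs, twistedReflect_parityOn_self hr hs hcard,
    parity_mul_cre, neg_mul, mul_assoc (cre (r x)), parity_mul_parityOn_compl, mul_neg, mul_assoc,
    ← mul_assoc (parityOn s), parityOn_mul_cre_of_notMem s _ hrx, mul_assoc (cre (r x)),
    parityOn_mul_self, mul_one, cre_mul_ann _ _ hne]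

/-! ### Reflection positivity -/

/-- The operators `X = ∑ᵢ Fᵢ θ(Fᵢ)`, `Y = ∑ᵢ Fᵢ θ(Gᵢ)`, `Z = ∑ᵢ Gᵢ θ(Gᵢ)` for some `Fᵢ`, `Gᵢ` in
`localAlgebra s`, with `θ` the twisted reflection. -/
def IsReflectionTriple {V : Type} [Fintype V] [DecidableEq V] (r : V → V) (s : Finset V)
    (X Y Z : FockOp V) : Prop :=
  ∃ (ι : Type) (_ : Fintype ι) (F G : ι → FockOp V), (∀ i, F i ∈ localAlgebra s) ∧
    (∀ i, G i ∈ localAlgebra s) ∧ X = ∑ i, F i * twistedReflect r s (F i) ∧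
    Y = ∑ i, F i * twistedReflect r s (G i) ∧ Z = ∑ i, G i * twistedReflect r s (G i)

theorem isReflectionTriple_of_mem {V : Type} [Fintype V] [DecidableEq V] (r : V → V)
    {s : Finset V} {A B : FockOp V} (hA : A ∈ localAlgebra s) (hB : B ∈ localAlgebra s) :
    IsReflectionTriple r s (A * twistedReflect r s A) (A * twistedReflect r s B)
      (B * twistedReflect r s B) :=
  ⟨Unit, inferInstance, fun _ => A, fun _ => B, fun _ => hA, fun _ => hB, by simp, by simp,
    by simp⟩

theorem IsReflectionTriple.zero {V : Type} [Fintype V] [DecidableEq V] (r : V → V)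
    (s : Finset V) : IsReflectionTriple r s 0 0 0 :=
  ⟨Empty, inferInstance, fun _ => 0, fun _ => 0, fun _ => zero_mem _, fun _ => zero_mem _,
    by simp, by simp, by simp⟩

theorem IsReflectionTriple.one {V : Type} [Fintype V] [DecidableEq V] (r : V → V)
    (s : Finset V) : IsReflectionTriple r s 1 1 1 := by
  have h := isReflectionTriple_of_mem r (one_mem (localAlgebra s)) (one_mem (localAlgebra s))
  rwa [twistedReflect_one, mul_one] at h

theorem IsReflectionTriple.add {V : Type} [Fintype V] [DecidableEq V] {r : V → V}
    {s : Finset V} {X Y Z X' Y' Z' : FockOp V} (h : IsReflectionTriple r s X Y Z)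
    (h' : IsReflectionTriple r s X' Y' Z') :
    IsReflectionTriple r s (X + X') (Y + Y') (Z + Z') := by
  obtain ⟨ι, _, F, G, hF, hG, rfl, rfl, rfl⟩ := h
  obtain ⟨κ, _, F', G', hF', hG', rfl, rfl, rfl⟩ := h'
  exact ⟨ι ⊕ κ, inferInstance, Sum.elim F F', Sum.elim G G', by rintro (i | i) <;> simp [hF, hF'],
    by rintro (i | i) <;> simp [hG, hG'], by simp, by simp, by simp⟩

theorem IsReflectionTriple.sum {V ι : Type} [Fintype V] [DecidableEq V] {r : V → V}
    {s : Finset V} {X Y Z : ι → FockOp V} (t : Finset ι)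
    (h : ∀ i ∈ t, IsReflectionTriple r s (X i) (Y i) (Z i)) :
    IsReflectionTriple r s (∑ i ∈ t, X i) (∑ i ∈ t, Y i) (∑ i ∈ t, Z i) := by
  classical
  induction t using Finset.induction with
  | empty => simpa using IsReflectionTriple.zero r s
  | insert i t hi ih =>
    rw [Finset.sum_insert hi, Finset.sum_insert hi, Finset.sum_insert hi]
    exact (h i (Finset.mem_insert_self i t)).add
      (ih fun j hj => h j (Finset.mem_insert_of_mem hj))

/-- The factor `√k` goes into every `F` and `G`; being real, it is unaffected by antilinearity. -/
theorem IsReflectionTriple.smul {V : Type} [Fintype V] [DecidableEq V] {r : V → V}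
    {s : Finset V} {X Y Z : FockOp V} (h : IsReflectionTriple r s X Y Z) {k : ℝ} (hk : 0 ≤ k) :
    IsReflectionTriple r s ((k : ℂ) • X) ((k : ℂ) • Y) ((k : ℂ) • Z) := by
  obtain ⟨ι, _, F, G, hF, hG, rfl, rfl, rfl⟩ := h
  have key : ∀ A B : FockOp V, (k : ℂ) • (A * twistedReflect r s B) =
      ((√k : ℝ) : ℂ) • A * twistedReflect r s (((√k : ℝ) : ℂ) • B) := by
    intro A B
    rw [twistedReflect_smul, smul_mul_smul_comm, Complex.conj_ofReal, ← Complex.ofReal_mul,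
      Real.mul_self_sqrt hk]
  exact ⟨ι, inferInstance, fun i => ((√k : ℝ) : ℂ) • F i, fun i => ((√k : ℝ) : ℂ) • G i,
    fun i => Subalgebra.smul_mem _ (hF i) _, fun i => Subalgebra.smul_mem _ (hG i) _,
    by simp only [Finset.smul_sum, key], by simp only [Finset.smul_sum, key],
    by simp only [Finset.smul_sum, key]⟩

/-- `F θ(G) F' θ(G') = F F' θ(G G')`, because `θ(G)` commutes with `F'`. -/
theorem IsReflectionTriple.mul {V : Type} [Fintype V] [DecidableEq V] {r : V → V}
    (hr : Function.Involutive r) {s : Finset V} (hs : ∀ x, r x ∈ s ↔ x ∉ s)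
    {X Y Z X' Y' Z' : FockOp V} (h : IsReflectionTriple r s X Y Z)
    (h' : IsReflectionTriple r s X' Y' Z') :
    IsReflectionTriple r s (X * X') (Y * Y') (Z * Z') := by
  obtain ⟨ι, _, F, G, hF, hG, rfl, rfl, rfl⟩ := h
  obtain ⟨κ, _, F', G', hF', hG', rfl, rfl, rfl⟩ := h'
  have key : ∀ (A B : ι → FockOp V) (A' B' : κ → FockOp V), (∀ i, B i ∈ localAlgebra s) →
      (∀ i, A' i ∈ localAlgebra s) →
      (∑ i, A i * twistedReflect r s (B i)) * ∑ i, A' i * twistedReflect r s (B' i) =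
        ∑ p : ι × κ, A p.1 * A' p.2 * twistedReflect r s (B p.1 * B' p.2) := by
    intro A B A' B' hB hA'
    rw [Finset.sum_mul_sum, Fintype.sum_prod_type]
    refine Finset.sum_congr rfl fun i _ => Finset.sum_congr rfl fun j _ => ?_
    rw [twistedReflect_mul, mul_assoc, ← mul_assoc (twistedReflect r s (B i)),
      (twistedReflect_commute hr hs (hA' j) (hB i)).eq]
    simp only [mul_assoc]
  exact ⟨ι × κ, inferInstance, fun p => F p.1 * F' p.2, fun p => G p.1 * G' p.2,
    fun p => mul_mem (hF _) (hF' _), fun p => mul_mem (hG _) (hG' _), key _ _ _ _ hF hF',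
    key _ _ _ _ hG hF', key _ _ _ _ hG hG'⟩

theorem IsReflectionTriple.pow {V : Type} [Fintype V] [DecidableEq V] {r : V → V}
    (hr : Function.Involutive r) {s : Finset V} (hs : ∀ x, r x ∈ s ↔ x ∉ s)
    {X Y Z : FockOp V} (h : IsReflectionTriple r s X Y Z) (n : ℕ) :
    IsReflectionTriple r s (X ^ n) (Y ^ n) (Z ^ n) := by
  induction n with
  | zero => simpa using IsReflectionTriple.one r s
  | succ n ih =>
    rw [pow_succ, pow_succ, pow_succ]
    exact ih.mul hr hs h

/-- The Cauchy-Schwarz inequality for reflection positive operators. -/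
theorem IsReflectionTriple.sq_norm_trace_le {V : Type} [Fintype V] [DecidableEq V] {r : V → V}
    (hr : Function.Involutive r) {s : Finset V} (hs : ∀ x, r x ∈ s ↔ x ∉ s)
    {X Y Z : FockOp V} (h : IsReflectionTriple r s X Y Z) :
    ‖Y.trace‖ ^ 2 ≤ X.trace.re * Z.trace.re := by
  obtain ⟨ι, _, F, G, hF, hG, rfl, rfl, rfl⟩ := h
  set d : ℝ := (Fintype.card (Finset V) : ℝ) with hd
  have hd0 : 0 < d := by
    rw [hd]
    exact_mod_cast Fintype.card_pos
  have ht : (1 : FockOp V).trace = (d : ℂ) := by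
    simp [hd]
  -- Up to the factor `1/d`, with `d` the dimension of the Fock space, the traces are inner products
  -- of the vectors `(Tr Aᵢ)` and `(Tr Bᵢ)`.
  have key : ∀ A B : ι → FockOp V, (∀ i, A i ∈ localAlgebra s) → (∀ i, B i ∈ localAlgebra s) →
      (∑ i, A i * twistedReflect r s (B i)).trace =
        ((d⁻¹ : ℝ) : ℂ) * ∑ i, (A i).trace * starRingEnd ℂ (B i).trace := by
    intro A B hA hB
    rw [Matrix.trace_sum, Finset.mul_sum]
    refine Finset.sum_congr rfl fun i _ => ?_
    rw [← trace_mul_twistedReflect hr hs (hA i) (hB i), ht]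
    have : (d : ℂ) ≠ 0 := by exact_mod_cast hd0.ne'
    push_cast
    field_simp
  have hdiag : ∀ A : ι → FockOp V, (∀ i, A i ∈ localAlgebra s) →
      (∑ i, A i * twistedReflect r s (A i)).trace.re = d⁻¹ * ∑ i, ‖(A i).trace‖ ^ 2 := by
    intro A hA
    rw [key A A hA hA, Complex.re_ofReal_mul, Complex.re_sum]
    congr 1
    refine Finset.sum_congr rfl fun i _ => ?_
    rw [Complex.mul_conj, Complex.ofReal_re, Complex.normSq_eq_norm_sq]
  rw [hdiag F hF, hdiag G hG, key F G hF hG, norm_mul, Complex.norm_real,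
    Real.norm_of_nonneg (inv_nonneg.mpr hd0.le), mul_pow]
  have h1 : ‖∑ i, (F i).trace * starRingEnd ℂ (G i).trace‖ ≤
      ∑ i, ‖(F i).trace‖ * ‖(G i).trace‖ := by
    refine (norm_sum_le _ _).trans (le_of_eq ?_)
    simp
  have h2 : ‖∑ i, (F i).trace * starRingEnd ℂ (G i).trace‖ ^ 2 ≤
      (∑ i, ‖(F i).trace‖ ^ 2) * ∑ i, ‖(G i).trace‖ ^ 2 :=
    (pow_le_pow_left₀ (norm_nonneg _) h1 2).trans (Finset.sum_mul_sq_le_sq_mul_sq _ _ _)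
  calc d⁻¹ ^ 2 * ‖∑ i, (F i).trace * starRingEnd ℂ (G i).trace‖ ^ 2 ≤
        d⁻¹ ^ 2 * ((∑ i, ‖(F i).trace‖ ^ 2) * ∑ i, ‖(G i).trace‖ ^ 2) :=
        mul_le_mul_of_nonneg_left h2 (by positivity)
    _ = _ := by ring

/-- An approximation of `exp ((A + θ(B) + K) / n)` to first order. -/
noncomputable def expStep {V : Type} [Fintype V] [DecidableEq V] (r : V → V) (s : Finset V)
    (K A B : FockOp V) (n : ℕ) : FockOp V :=
  (1 + (((n : ℝ)⁻¹ : ℝ) : ℂ) • A) * twistedReflect r s (1 + (((n : ℝ)⁻¹ : ℝ) : ℂ) • B) +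
    (((n : ℝ)⁻¹ : ℝ) : ℂ) • K

/-- The product `(1 + A/n) θ(1 + B/n)` has the form `F θ(G)` as it stands. Its cross term beyond `1
+ (A + θ(B))/n` is of order `1/n²` and disappears in the limit. -/
theorem isReflectionTriple_expStep {V : Type} [Fintype V] [DecidableEq V] {r : V → V}
    {s : Finset V} {K A B : FockOp V} (hK : IsReflectionTriple r s K K K)
    (hA : A ∈ localAlgebra s) (hB : B ∈ localAlgebra s) (n : ℕ) :
    IsReflectionTriple r s (expStep r s K A A n) (expStep r s K A B n) (expStep r s K B B n) :=
  (isReflectionTriple_of_mem r (add_mem (one_mem _) (Subalgebra.smul_mem _ hA _))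
    (add_mem (one_mem _) (Subalgebra.smul_mem _ hB _))).add
    (hK.smul (inv_nonneg.mpr n.cast_nonneg))

open scoped Matrix.Norms.Operator in
theorem tendsto_expStep_pow {V : Type} [Fintype V] [DecidableEq V] (r : V → V) (s : Finset V)
    (K A B : FockOp V) :
    Filter.Tendsto (fun n : ℕ => expStep r s K A B n ^ n) Filter.atTop
      (nhds (NormedSpace.exp (A + twistedReflect r s B + K))) := by
  apply tendsto_pow_exp
  -- This is the only error term in `n (expStep - 1)`.
  have h0 : Filter.Tendsto (fun n : ℕ => (n : ℝ)⁻¹ • (A * twistedReflect r s B)) Filter.atTop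
      (nhds 0) := by
    have h := (tendsto_inv_atTop_nhds_zero_nat (𝕜 := ℝ)).smul_const (A * twistedReflect r s B)
    rwa [zero_smul] at h
  have h1 := h0.const_add (A + twistedReflect r s B + K)
  rw [add_zero] at h1
  refine h1.congr' ?_
  filter_upwards [Filter.eventually_gt_atTop 0] with n hn
  have hn' : (n : ℝ) ≠ 0 := by exact_mod_cast hn.ne'
  have e : ∀ (k : ℝ) (X : FockOp V), (k : ℂ) • X = k • X := fun k X => Complex.coe_smul k X
  rw [expStep, twistedReflect_add, twistedReflect_one, twistedReflect_smul, Complex.conj_ofReal,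
    e, e, e, add_mul, one_mul, mul_add, mul_one, smul_mul_smul_comm, ← sub_eq_zero]
  match_scalars <;> field_simp <;> ring

/-- The weight `Q θ(Q)` serves both partition functions: `Q = 1` gives the trace, and the parity of
the left half gives the trace with `(-1)^N`. -/
theorem trace_exp_sq_le {V : Type} [Fintype V] [DecidableEq V] {r : V → V}
    (hr : Function.Involutive r) {s : Finset V} (hs : ∀ x, r x ∈ s ↔ x ∉ s)
    {K Q A B : FockOp V} (hK : IsReflectionTriple r s K K K) (hQ : Q ∈ localAlgebra s)
    (hA : A ∈ localAlgebra s) (hB : B ∈ localAlgebra s) :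
    ‖(Q * twistedReflect r s Q * NormedSpace.exp (A + twistedReflect r s B + K)).trace‖ ^ 2 ≤
      (Q * twistedReflect r s Q * NormedSpace.exp (A + twistedReflect r s A + K)).trace.re *
      (Q * twistedReflect r s Q * NormedSpace.exp (B + twistedReflect r s B + K)).trace.re := by
  have hc : Continuous fun M : FockOp V => (Q * twistedReflect r s Q * M).trace :=
    (continuous_const.matrix_mul continuous_id).matrix_trace
  have lim : ∀ A B : FockOp V, Filter.Tendsto
      (fun n : ℕ => (Q * twistedReflect r s Q * expStep r s K A B n ^ n).trace) Filter.atTop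
      (nhds (Q * twistedReflect r s Q *
        NormedSpace.exp (A + twistedReflect r s B + K)).trace) := fun A B =>
    (hc.tendsto _).comp (tendsto_expStep_pow r s K A B)
  refine le_of_tendsto_of_tendsto' ((lim A B).norm.pow 2)
    (((Complex.continuous_re.tendsto _).comp (lim A A)).mul
      ((Complex.continuous_re.tendsto _).comp (lim B B))) fun n => ?_
  exact ((isReflectionTriple_of_mem r hQ hQ).mul hr hs
    ((isReflectionTriple_expStep hK hA hB n).pow hr hs n)).sq_norm_trace_le hr hs

/-! ### The cut torus -/

theorem shift_eq_siteReflection {L : ℕ} [NeZero L] (hL : Even L) (μ : Fin 2) (c : ZMod L)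
    {x : Site L} (hx : x ∈ leftHalf μ c) (hx' : shift μ x ∈ rightHalf μ c) :
    shift μ x = siteReflection μ c x := by
  have hL0 : L ≠ 0 := NeZero.ne L
  obtain ⟨ℓ, hℓ⟩ := hL
  simp only [rightHalf, leftHalf, Finset.mem_compl, Finset.mem_filter, Finset.mem_univ, true_and,
    shift, Pi.add_apply, Pi.single_eq_same] at hx hx'
  set j := (x μ - c).val with hj
  have hxj : x μ = c + (j : ZMod L) := by
    rw [hj, ZMod.natCast_zmod_val]
    ring
  have e1 : x μ + 1 - c = ((j + 1 : ℕ) : ZMod L) := by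
    rw [hxj]
    push_cast
    ring
  rw [e1, ZMod.val_natCast, Nat.mod_eq_of_lt (by omega)] at hx'
  -- Leaving the left half forces `j = L/2 - 1`. The coordinates `c + j + 1` and `c - 1 - j` differ
  -- by `2 (j + 1) = L`.
  have h2 : (2 : ZMod L) * ((j : ZMod L) + 1) = 0 := by
    have h3 : 2 * (j + 1) = L := by omega
    have h4 := congrArg (Nat.cast : ℕ → ZMod L) h3
    rw [ZMod.natCast_self] at h4
    exact_mod_cast h4
  funext i
  by_cases hi : i = μ
  · subst hi
    simp only [shift, siteReflection, Pi.add_apply, Pi.single_eq_same, Function.update_self]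
    rw [hxj]
    linear_combination h2
  · simp [shift, siteReflection, hi]

theorem siteReflection_shift {L : ℕ} [NeZero L] (hL : Even L) (μ : Fin 2) (c : ZMod L)
    {x : Site L} (hx : x ∈ rightHalf μ c) (hx' : shift μ x ∈ leftHalf μ c) :
    siteReflection μ c (shift μ x) = x := by
  have hL0 : L ≠ 0 := NeZero.ne L
  obtain ⟨ℓ, hℓ⟩ := hL
  simp only [rightHalf, leftHalf, Finset.mem_compl, Finset.mem_filter, Finset.mem_univ, true_and,
    shift, Pi.add_apply, Pi.single_eq_same] at hx hx'
  have hlt := ZMod.val_lt (x μ - c)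
  set j := (x μ - c).val with hj
  have hxj : x μ = c + (j : ZMod L) := by
    rw [hj, ZMod.natCast_zmod_val]
    ring
  have e1 : x μ + 1 - c = ((j + 1 : ℕ) : ZMod L) := by
    rw [hxj]
    push_cast
    ring
  -- Here `j ≥ L/2`, so a step that did not wrap around the torus would stay in the right half.
  have h3 : j + 1 = L := by
    by_contra hne
    rw [e1, ZMod.val_natCast, Nat.mod_eq_of_lt (by omega)] at hx'
    omega
  have h2 : (j : ZMod L) + 1 = 0 := by
    have h4 := congrArg (Nat.cast : ℕ → ZMod L) h3
    rw [ZMod.natCast_self] at h4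
    exact_mod_cast h4
  funext i
  by_cases hi : i = μ
  · subst hi
    simp only [shift, siteReflection, Pi.add_apply, Pi.single_eq_same, Function.update_self]
    rw [hxj]
    linear_combination -2 * h2
  · simp [shift, siteReflection, hi]

theorem even_card_leftHalf {L : ℕ} [NeZero L] (hL : Even L) (μ : Fin 2) (c : ZMod L) :
    Even (leftHalf μ c).card := by
  have h1 := image_eq_compl (siteReflection_involutive μ c) (siteReflection_mem hL μ c)
  have h2 := congrArg Finset.card h1
  rw [Finset.card_image_of_injective _ (siteReflection_involutive μ c).injective] at h2
  have h3 := Finset.card_add_card_compl (leftHalf μ c)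
  have h4 : Fintype.card (Site L) = L ^ 2 := by simp [ZMod.card]
  obtain ⟨ℓ, rfl⟩ := hL
  -- With `L = 2ℓ`, each half has `L²/2 = 2ℓ²` sites.
  exact ⟨ℓ ^ 2, by nlinarith⟩

/-- The sign of the hopping matters: `(-β)(-t) = βt ≥ 0`, so `-β V_int` is a nonnegative combination
of terms `F θ(F)`. Both lines of cut bonds join a left site to its mirror image. -/
theorem isReflectionTriple_cutHopping {L : ℕ} [NeZero L] (hL : Even L) (μ : Fin 2) (c : ZMod L)
    {t β : ℝ} (ht : 0 ≤ t) (hβ : 0 ≤ β) :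
    IsReflectionTriple (siteReflection μ c) (leftHalf μ c) (-(β : ℂ) • cutHopping μ c t)
      (-(β : ℂ) • cutHopping μ c t) (-(β : ℂ) • cutHopping μ c t) := by
  have hb : ∀ z ∈ leftHalf μ c, IsReflectionTriple (siteReflection μ c) (leftHalf μ c)
      (cre z * ann (siteReflection μ c z) + cre (siteReflection μ c z) * ann z)
      (cre z * ann (siteReflection μ c z) + cre (siteReflection μ c z) * ann z)
      (cre z * ann (siteReflection μ c z) + cre (siteReflection μ c z) * ann z) := by
    intro z hz
    rw [cre_mul_ann_eq_twisted (siteReflection_involutive μ c) (siteReflection_mem hL μ c)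
      (even_card_leftHalf hL μ c) hz, cre_mul_ann_eq_twisted' (siteReflection_involutive μ c)
      (siteReflection_mem hL μ c) (even_card_leftHalf hL μ c) hz]
    have hp := parityOn_mem_localAlgebra (leftHalf μ c)
    have h1 := mul_mem (cre_mem_localAlgebra hz) hp
    have h2 := mul_mem (ann_mem_localAlgebra hz) hp
    exact (isReflectionTriple_of_mem _ h1 h1).add (isReflectionTriple_of_mem _ h2 h2)
  rw [cutHopping, smul_smul, neg_mul_neg, ← Complex.ofReal_mul]
  refine IsReflectionTriple.smul (IsReflectionTriple.sum _ fun x hx => ?_) (mul_nonneg hβ ht)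
  rcases (Finset.mem_filter.mp hx).2 with ⟨h1, h2⟩ | ⟨h1, h2⟩
  · rw [shift_eq_siteReflection hL μ c h1 h2]
    exact hb x h1
  · have h := hb _ h2
    rw [siteReflection_shift hL μ c h1 h2] at h
    rwa [add_comm] at h

/-! ### Self-adjointness and reality -/

theorem cutHopping_isHermitian {L : ℕ} [NeZero L] (μ : Fin 2) (c : ZMod L) (t : ℝ) :
    (cutHopping μ c t).IsHermitian := by
  rw [Matrix.IsHermitian, cutHopping, Matrix.conjTranspose_smul, Matrix.conjTranspose_sum]
  congr 1
  · simp
  · refine Finset.sum_congr rfl fun x _ => ?_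
    rw [Matrix.conjTranspose_add, Matrix.conjTranspose_mul, Matrix.conjTranspose_mul,
      cre_conjTranspose, cre_conjTranspose, add_comm]
    rfl

theorem exp_isHermitian {L : ℕ} [NeZero L] (μ : Fin 2) (c : ZMod L) (t β : ℝ)
    {H₁ H₂ : FockOp (Site L)} (h₁ : H₁.IsHermitian) (h₂ : H₂.IsHermitian) :
    (NormedSpace.exp (-(β : ℂ) • (H₁ + H₂ + cutHopping μ c t))).IsHermitian := by
  refine Matrix.IsHermitian.exp ?_
  rw [Matrix.IsHermitian, Matrix.conjTranspose_smul,
    ((h₁.add h₂).add (cutHopping_isHermitian μ c t)).eq]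
  simp

theorem evenZ_im {L : ℕ} [NeZero L] (μ : Fin 2) (c : ZMod L) (t β : ℝ)
    {H₁ H₂ : FockOp (Site L)} (h₁ : H₁.IsHermitian) (h₂ : H₂.IsHermitian) :
    (evenZ μ c t β H₁ H₂).im = 0 := by
  rw [← Complex.conj_eq_iff_im, evenZ, starRingEnd_apply, ← Matrix.trace_conjTranspose,
    (exp_isHermitian μ c t β h₁ h₂).eq]

theorem oddZ_im {L : ℕ} [NeZero L] (μ : Fin 2) (c : ZMod L) (t β : ℝ)
    {H₁ H₂ : FockOp (Site L)} (h₁ : H₁.IsHermitian) (h₂ : H₂.IsHermitian) :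
    (oddZ μ c t β H₁ H₂).im = 0 := by
  rw [← Complex.conj_eq_iff_im, oddZ, starRingEnd_apply, ← Matrix.trace_conjTranspose,
    Matrix.conjTranspose_mul, (exp_isHermitian μ c t β h₁ h₂).eq, parity_conjTranspose,
    Matrix.trace_mul_comm]

theorem theta_isHermitian {L : ℕ} [NeZero L] (μ : Fin 2) (c : ZMod L) {H : FockOp (Site L)}
    (h : H.IsHermitian) : (theta μ c H).IsHermitian := by
  rw [Matrix.IsHermitian, theta, ← reflect_conjTranspose, h.eq]

theorem sq_re_le_sq_norm (z : ℂ) : z.re ^ 2 ≤ ‖z‖ ^ 2 :=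
  sq_le_sq.mpr ((Complex.abs_re_le_norm z).trans (le_abs_self _))

/-- Reflection positivity of the cut torus, weighted with `Q θ(Q)`. -/
theorem trace_mul_exp_sq_le {L : ℕ} [NeZero L] (hL : Even L) (μ : Fin 2) (c : ZMod L)
    {t β : ℝ} (ht : 0 ≤ t) (hβ : 0 ≤ β) {Hl Hr Q : FockOp (Site L)}
    (hl : Hl ∈ localAlgebra (leftHalf μ c)) (hl_N : Commute Hl (number (Site L)))
    (hr : Hr ∈ localAlgebra (rightHalf μ c)) (hr_N : Commute Hr (number (Site L)))
    (hQ : Q ∈ localAlgebra (leftHalf μ c)) :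
    ‖(Q * twistedReflect (siteReflection μ c) (leftHalf μ c) Q *
        NormedSpace.exp (-(β : ℂ) • (Hl + Hr + cutHopping μ c t))).trace‖ ^ 2 ≤
      (Q * twistedReflect (siteReflection μ c) (leftHalf μ c) Q *
        NormedSpace.exp (-(β : ℂ) • (Hl + theta μ c Hl + cutHopping μ c t))).trace.re *
      (Q * twistedReflect (siteReflection μ c) (leftHalf μ c) Q *
        NormedSpace.exp (-(β : ℂ) • (Hr + theta μ c Hr + cutHopping μ c t))).trace.re := by
  have hi := siteReflection_involutive (L := L) μ c
  have hm := siteReflection_mem hL μ c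
  have hB : theta μ c Hr ∈ localAlgebra (leftHalf μ c) :=
    reflect_mem_localAlgebra hi hm (fun x hx => (hm x).mpr (Finset.mem_compl.mp hx)) hr
  have hBN : Commute (theta μ c Hr) (number (Site L)) := reflect_commute_number hi hm hr_N
  -- With `A = -β Hl` and `B = -β Θ(Hr)`, both on the left half, `θ(B) = -β Hr`; the mixed term is
  -- then the original system.
  have h := trace_exp_sq_le hi hm (isReflectionTriple_cutHopping hL μ c ht hβ) hQ
    (Subalgebra.smul_mem _ hl (-(β : ℂ))) (Subalgebra.smul_mem _ hB (-(β : ℂ)))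
  have e1 : twistedReflect (siteReflection μ c) (leftHalf μ c) Hl = theta μ c Hl :=
    twistedReflect_eq_reflect hi hm hl_N
  have e2 : twistedReflect (siteReflection μ c) (leftHalf μ c) (theta μ c Hr) = Hr :=
    (twistedReflect_eq_reflect hi hm hBN).trans (reflect_reflect hi hm hr)
  simp only [twistedReflect_smul, e1, e2, map_neg, Complex.conj_ofReal, ← smul_add] at h
  rwa [add_comm (theta μ c Hr) Hr] at h

end LatticeFermion

theorem lemma3p1 (L : ℕ) [NeZero L] (hL : Even L) (μ : Fin 2) (c : ZMod L)
    (t β : ℝ) (ht : 0 < t) (hβ : 0 ≤ β)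
    (Hl Hr : FockOp (Site L))
    (hl : Hl ∈ localAlgebra (leftHalf μ c)) (hl_sa : Hl.IsHermitian)
    (hl_N : Commute Hl (number (Site L)))
    (hr : Hr ∈ localAlgebra (rightHalf μ c)) (hr_sa : Hr.IsHermitian)
    (hr_N : Commute Hr (number (Site L))) :
    ((evenZ μ c t β Hl Hr).im = 0 ∧ (evenZ μ c t β Hl (theta μ c Hl)).im = 0 ∧
      (evenZ μ c t β Hr (theta μ c Hr)).im = 0 ∧
      (evenZ μ c t β Hl Hr).re ^ 2 ≤
        (evenZ μ c t β Hl (theta μ c Hl)).re * (evenZ μ c t β Hr (theta μ c Hr)).re) ∧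
    ((oddZ μ c t β Hl Hr).im = 0 ∧ (oddZ μ c t β Hl (theta μ c Hl)).im = 0 ∧
      (oddZ μ c t β Hr (theta μ c Hr)).im = 0 ∧
      (oddZ μ c t β Hl Hr).re ^ 2 ≤
        (oddZ μ c t β Hl (theta μ c Hl)).re * (oddZ μ c t β Hr (theta μ c Hr)).re) := by
  have hm := siteReflection_mem hL μ c
  have hΘl := theta_isHermitian μ c hl_sa
  have hΘr := theta_isHermitian μ c hr_sa
  refine ⟨⟨evenZ_im μ c t β hl_sa hr_sa, evenZ_im μ c t β hl_sa hΘl,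
    evenZ_im μ c t β hr_sa hΘr, (sq_re_le_sq_norm _).trans ?_⟩,
    oddZ_im μ c t β hl_sa hr_sa, oddZ_im μ c t β hl_sa hΘl,
    oddZ_im μ c t β hr_sa hΘr, (sq_re_le_sq_norm _).trans ?_⟩
  -- Weight `Q = 1`.
  · have h := trace_mul_exp_sq_le hL μ c ht.le hβ hl hl_N hr hr_N (one_mem _)
    rwa [twistedReflect_one, mul_one, one_mul, one_mul, one_mul] at h
  -- Weight `Q = (-1)^{N_l}`, for which `Q θ(Q) = (-1)^N`.
  · have h := trace_mul_exp_sq_le hL μ c ht.le hβ hl hl_N hr hr_N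
      (parityOn_mem_localAlgebra (leftHalf μ c))
    rwa [twistedReflect_parityOn_self (siteReflection_involutive μ c) hm
      (even_card_leftHalf hL μ c), parityOn_mul_compl] at h
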